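/- Let $d\ge 1$ and let $\Omega\subset\mathbb{R}^d$ be a nonempty bounded open set whose boundary $\partial\Omega$ is of class $C^1$, with outward unit normal $\mathrm{n}$ and surface measure $dS$ on $\partial\Omega$. There is a constant $C>0$, depending only on $d$ and $\Omega$, such that the following holds. Let $\sigma>0$, $\lambda>0$, $\delta\in\mathbb{R}$, let $f\in L^2(\Omega)$, $g\in L^2(\partial\Omega)$, and let $c\in L^2(\Omega)$ satisfy $c\ge\sigma$ a.e. in $\Omega$. Let $u_*\in C^1(\overline\Omega)$ be a solution of the Neumann problem $$-\Delta u+cu=f\ \text{ in }\Omega,\qquad \frac{\partial u}{\partial \mathrm{n}}=g\ \text{ on }\partial\Omega,$$ where the equation is understood in the sense of distributions and the boundary condition holds a.e. on $\partial\Omega$. Let $\mathcal N\subset C^2(\overline\Omega)$, and for $u\in\mathcal N$ put $$J(u)=\int_\Omega|-\Delta u+cu-f|^2\,dx+\lambda\int_{\partial\Omega}\Big|\frac{\partial u}{\partial \mathrm{n}}-g\Big|^2\,dS.$$ (1) If $u_{\mathrm b}\in\mathcal N$ satisfies $J(u_{\mathrm b})<\delta$, then $$\|u_{\mathrm b}-u_*\|_{H^1(\Omega)}\le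 C\,\max(1,\sigma^{-1})\,\max(1,\lambda^{-1/2})\,\delta^{1/2}.$$ (2) Let $\varepsilon>0$, let $\mathcal S'$ be a set of positive functions in $C(\Omega)$ containing the constant function $1$, and let $\mathcal S''$ be a set of positive functions in $C(\partial\Omega)$ containing the constant function $1$. For $u\in\mathcal N$ let $$J_{\mathcal S',\mathcal S''}(u)=\sup_{\phi'\in\mathcal S',\,\phi''\in\mathcal S''}\bigg\{\int_\Omega\phi'|-\Delta u+cu-f|^2dx+\lambda\int_{\partial\Omega}\phi''\Big|\frac{\partial u}{\partial \mathrm{n}}-g\Big|^2dS-\varepsilon^{-1}\bigg[\Big(\frac1{|\Omega|}\int_\Omega\phi'dx-1\Big)^2+\Big(\frac1{|\partial\Omega|}\int_{\partial\Omega}\phi''dS-1\Big)^2\bigg]\bigg\},$$ the supremum being taken in $[-\infty,\infty]$ and the expression in braces being $-\infty$ if $\int_\Omega\phi'dx=\infty$. If $u_{\mathrm s}\in\mathcal N$ satisfies $J_{\mathcal S',\mathcal S''}(u_{\mathrm s})<\delta$, then, with the same constant $C$, $$\|u_{\mathrm s}-u_*\|_{H^1(\Omega)}\le C\,\max(1,\sigma^{-1})\,\max(1,\lambda^{-1/2})\,\delta^{1/2}.$$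 -/

import Mathlib

open MeasureTheory Set Topology InnerProductSpace
open scoped ENNReal ContDiff

namespace NeumannLS

/-- Euclidean space `ℝ^d` with the Euclidean norm. -/
abbrev Space (d : ℕ) : Type := EuclideanSpace ℝ (Fin d)

/-- The boundary of `Ω` is of class `C¹`: near every boundary point `Ω` is the region strictly above
the graph of a `C¹` function `γ` over a hyperplane `νᗮ`, where "above" means in the direction of the
unit vector `ν`. -/
def HasC1Boundary {d : ℕ} (Ω : Set (Space d)) : Prop :=
  ∀ x ∈ frontier Ω, ∃ (ν : Space d) (γ : (ℝ ∙ ν)ᗮ → ℝ), ‖ν‖ = 1 ∧ ContDiff ℝ 1 γ ∧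
    ∀ᶠ y in 𝓝 x, (y ∈ Ω ↔ γ ((ℝ ∙ ν)ᗮ.orthogonalProjectionOnto y) < inner ℝ ν y)

/-- `n` is an outward unit normal of `Ω` at `x`: it is the normalized gradient at `x` of a local `C¹`
defining function `ψ` (zero at `x`, with non-zero gradient there, and negative near `x` exactly
on `Ω`). -/
def IsOutwardUnitNormal {d : ℕ} (Ω : Set (Space d)) (x n : Space d) : Prop :=
  ∃ ψ : Space d → ℝ, ContDiffAt ℝ 1 ψ x ∧ ψ x = 0 ∧ gradient ψ x ≠ 0 ∧
    (∀ᶠ y in 𝓝 x, (y ∈ Ω ↔ ψ y < 0)) ∧ n = ‖gradient ψ x‖⁻¹ • gradient ψ x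

open Classical in
/-- The outward unit normal of `Ω` at `x`. It exists uniquely at every boundary point when the
boundary is `C¹`; the value is zero where there is none. -/
noncomputable def outwardNormal {d : ℕ} (Ω : Set (Space d)) (x : Space d) : Space d :=
  if h : ∃ n, IsOutwardUnitNormal Ω x n then h.choose else 0

/-- The surface measure on `∂Ω`: the `(d-1)`-dimensional Hausdorff measure, normalized to agree with
Lebesgue measure on `(d-1)`-dimensional Euclidean spaces, restricted to the boundary. -/
noncomputable def surfaceMeasure {d : ℕ} (Ω : Set (Space d)) : Measure (Space d) :=
  (μHE[d - 1] : Measure (Space d)).restrict (frontier Ω)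

/-- The normal derivative `∂u/∂n` at a boundary point `x`, for `u` differentiable up to the boundary
(the derivative is the one within the closure of `Ω`). -/
noncomputable def normalDeriv {d : ℕ} (Ω : Set (Space d)) (u : Space d → ℝ) (x : Space d) : ℝ :=
  fderivWithin ℝ u (closure Ω) x (outwardNormal Ω x)

/-- `u ∈ C¹(Ω̄)` solves `-Δu + cu = f` in `Ω` in the sense of distributions, and
`∂u/∂n = g` on `∂Ω`. -/
structure IsNeumannSolution {d : ℕ} (Ω : Set (Space d)) (c f g u : Space d → ℝ) : Prop where
  contDiffOn : ContDiffOn ℝ 1 u (closure Ω)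
  equation : ∀ φ : Space d → ℝ, ContDiff ℝ ∞ φ → HasCompactSupport φ → tsupport φ ⊆ Ω →
    (∫ x in Ω, inner ℝ (gradient u x) (gradient φ x)) + ∫ x in Ω, c x * u x * φ x =
      ∫ x in Ω, f x * φ x
  boundary : ∀ᵐ x ∂(surfaceMeasure Ω), normalDeriv Ω u x = g x

/-- The residual `-Δu + cu - f` of the equation. -/
noncomputable def interiorResidual {d : ℕ} (c f u : Space d → ℝ) (x : Space d) : ℝ :=
  -(Laplacian.laplacian u x) + c x * u x - f x

/-- The residual `∂u/∂n - g` of the boundary condition. -/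
noncomputable def boundaryResidual {d : ℕ} (Ω : Set (Space d)) (g u : Space d → ℝ)
    (x : Space d) : ℝ :=
  normalDeriv Ω u x - g x

/-- The least squares loss
`J(u) = ∫_Ω |-Δu + cu - f|² dx + lam ∫_∂Ω |∂u/∂n - g|² dS`. -/
noncomputable def leastSquaresLoss {d : ℕ} (Ω : Set (Space d)) (c f g : Space d → ℝ) (lam : ℝ)
    (u : Space d → ℝ) : ℝ≥0∞ :=
  (∫⁻ x in Ω, ‖interiorResidual c f u x‖ₑ ^ 2) +
    ENNReal.ofReal lam * ∫⁻ x, ‖boundaryResidual Ω g u x‖ₑ ^ 2 ∂(surfaceMeasure Ω)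

/-- Lebesgue measure as a measure on the subtype `Ω`. -/
noncomputable def interiorMeasure {d : ℕ} (Ω : Set (Space d)) : Measure Ω :=
  (volume : Measure (Space d)).comap Subtype.val

/-- The surface measure as a measure on the subtype `∂Ω`. -/
noncomputable def boundaryMeasure {d : ℕ} (Ω : Set (Space d)) : Measure (frontier Ω) :=
  (surfaceMeasure Ω).comap Subtype.val

/-- The weighted loss
`∫_Ω φ₁ |-Δu + cu - f|² dx + lam ∫_∂Ω φ₂ |∂u/∂n - g|² dS` for positive weights `φ₁`, `φ₂`. -/
noncomputable def weightedLoss {d : ℕ} (Ω : Set (Space d)) (c f g : Space d → ℝ) (lam : ℝ)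
    (u : Space d → ℝ) (φ₁ : C(Ω, ℝ)) (φ₂ : C(frontier Ω, ℝ)) : ℝ≥0∞ :=
  (∫⁻ x, ENNReal.ofReal (φ₁ x) * ‖interiorResidual c f u x‖ₑ ^ 2 ∂(interiorMeasure Ω)) +
    ENNReal.ofReal lam *
      ∫⁻ x, ENNReal.ofReal (φ₂ x) * ‖boundaryResidual Ω g u x‖ₑ ^ 2 ∂(boundaryMeasure Ω)

/-- The mean `|Ω|⁻¹ ∫_Ω φ dx` of a positive function on `Ω`. -/
noncomputable def interiorMean {d : ℕ} (Ω : Set (Space d)) (φ : C(Ω, ℝ)) : ℝ≥0∞ :=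
  (∫⁻ x, ENNReal.ofReal (φ x) ∂(interiorMeasure Ω)) / volume Ω

/-- The mean `|∂Ω|⁻¹ ∫_∂Ω φ dS` of a positive function on `∂Ω`. -/
noncomputable def boundaryMean {d : ℕ} (Ω : Set (Space d)) (φ : C(frontier Ω, ℝ)) : ℝ≥0∞ :=
  (∫⁻ x, ENNReal.ofReal (φ x) ∂(boundaryMeasure Ω)) / surfaceMeasure Ω univ

/-- The penalized weighted loss: the weighted loss minus
`ε⁻¹ [(|Ω|⁻¹ ∫_Ω φ₁ dx - 1)² + (|∂Ω|⁻¹ ∫_∂Ω φ₂ dS - 1)²]`. Its values are extended reals, as the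
integrals of unbounded weights may be infinite; a weight of infinite mass gives the value `-∞`. -/
noncomputable def penalizedLoss {d : ℕ} (Ω : Set (Space d)) (c f g : Space d → ℝ) (lam ε : ℝ)
    (u : Space d → ℝ) (φ₁ : C(Ω, ℝ)) (φ₂ : C(frontier Ω, ℝ)) : EReal :=
  (weightedLoss Ω c f g lam u φ₁ φ₂ : EReal) -
    ((ε⁻¹ : ℝ) : EReal) *
      (((interiorMean Ω φ₁ : EReal) - 1) ^ 2 + ((boundaryMean Ω φ₂ : EReal) - 1) ^ 2)

/-- The SelectNet loss: the largest value (least upper bound) of the penalized loss of `u` over the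
selection functions `φ₁ ∈ S₁` and `φ₂ ∈ S₂`. -/
noncomputable def selectNetLoss {d : ℕ} (Ω : Set (Space d)) (c f g : Space d → ℝ) (lam ε : ℝ)
    (S₁ : Set C(Ω, ℝ)) (S₂ : Set C(frontier Ω, ℝ)) (u : Space d → ℝ) : EReal :=
  ⨆ φ₁ ∈ S₁, ⨆ φ₂ ∈ S₂, penalizedLoss Ω c f g lam ε u φ₁ φ₂

/-- The norm `‖v‖_{H¹(Ω)} = (∫_Ω |v|² + |∇v|² dx)^{1/2}` of a function that is continuously
differentiable in `Ω` (so that its weak gradient is the classical one). -/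
noncomputable def h1Norm {d : ℕ} (Ω : Set (Space d)) (v : Space d → ℝ) : ℝ≥0∞ :=
  (∫⁻ x in Ω, (‖v x‖ₑ ^ 2 + ‖gradient v x‖ₑ ^ 2)) ^ (1 / 2 : ℝ)

end NeumannLS

/-!
The difference `w = u - ustar` solves, weakly in `Ω`, the equation `-Δw + c w = R`, where `R` is the
interior residual of `u`, and its normal derivative is the boundary residual `r` of `u`. Testing
the equation with `w` gives `∫ |∇w|² + c w² = ∫ R w + ∫_∂Ω r w`; the left side is at least
`min 1 σ * ‖w‖²` in `H¹`, and the trace inequality bounds the right side by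
`(‖R‖ + C ‖r‖) ‖w‖`. Since `‖R‖² ≤ δ` and `‖r‖² ≤ δ / lam`, the estimate follows. The SelectNet loss
is at least the least squares loss, because the weights `1`, `1` carry no penalty; this uses that the
surface measure of the boundary is positive and finite.

The point that needs care is the boundary term, as `ustar` is only `C¹` up to the boundary and has its
Laplacian only in the sense of distributions. In a chart in which `Ω` lies above the graph of a `C¹`
function, the weak equation is tested with `χ w` multiplied by a cutoff that vanishes in a layer of
thickness `t` along the graph (`C¹` test functions being admissible by mollification,
`weak_eq_of_contDiff_one`). As `t → 0`, the derivative of the cutoff concentrates on the graph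
(`tendsto_integral_layer`), which gives Green's formula with the boundary integral written in
the base coordinates (`IsGraphChart.integral_cutoff_eq_neg_flux`). Only an upper bound of this term is
needed, so no area formula enters: the orthogonal projection onto the base is `1`-Lipschitz, hence the
base measure, lifted to the graph, is at most the surface measure
(`IsGraphChart.map_graphPoint_le`). The trace inequality is the fundamental theorem of calculus along
the chart direction (`lintegral_graph_le`). A partition of unity on `closure Ω` combines the charts
(`HasC1Boundary.exists_green_bound`).
-/

/-! ### Heights above a graph, outward normals and graph charts -/

namespace NeumannLS

section Height

variable {E : Type*} [NormedAddCommGroup E] [InnerProductSpace ℝ E]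

/-- The signed height of `x` above the graph of `γ`, measured along `ν`. -/
noncomputable def height (ν : E) (γ : (ℝ ∙ ν)ᗮ → ℝ) (x : E) : ℝ :=
  inner ℝ ν x - γ ((ℝ ∙ ν)ᗮ.orthogonalProjectionOnto x)

/-- The point at height `s` above the graph of `γ`, over the base point `y`. -/
noncomputable def graphPoint (ν : E) (γ : (ℝ ∙ ν)ᗮ → ℝ) (y : (ℝ ∙ ν)ᗮ) (s : ℝ) : E :=
  (y : E) + (s + γ y) • ν

variable {ν : E} {γ : (ℝ ∙ ν)ᗮ → ℝ}

lemma contDiff_height [FiniteDimensional ℝ E] (hγ : ContDiff ℝ 1 γ) :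
    ContDiff ℝ 1 (height ν γ) := by
  unfold height
  exact (contDiff_const.inner ℝ contDiff_id).sub
    (hγ.comp (ContinuousLinearMap.contDiff _))

lemma continuous_graphPoint (hγ : Continuous γ) :
    Continuous fun p : (ℝ ∙ ν)ᗮ × ℝ ↦ graphPoint ν γ p.1 p.2 := by
  unfold graphPoint
  fun_prop

lemma orthogonalProjection_add_smul (y : (ℝ ∙ ν)ᗮ) (a : ℝ) :
    (ℝ ∙ ν)ᗮ.orthogonalProjectionOnto ((y : E) + a • ν) = y := by
  have h1 : (ℝ ∙ ν)ᗮ.orthogonalProjectionOnto (a • ν) = 0 := by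
    rw [Submodule.orthogonalProjectionOnto_eq_zero_iff]
    exact Submodule.le_orthogonal_orthogonal _ (Submodule.smul_mem _ _
      (Submodule.mem_span_singleton_self ν))
  simp [h1]

lemma inner_orthogonal_eq_zero (y : (ℝ ∙ ν)ᗮ) : inner ℝ ν (y : E) = 0 :=
  Submodule.mem_orthogonal_singleton_iff_inner_right.1 y.2

lemma orthogonalProjection_graphPoint (y : (ℝ ∙ ν)ᗮ) (s : ℝ) :
    (ℝ ∙ ν)ᗮ.orthogonalProjectionOnto (graphPoint ν γ y s) = y :=
  orthogonalProjection_add_smul _ _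

lemma graphPoint_zero_injective :
    Function.Injective fun y : (ℝ ∙ ν)ᗮ ↦ graphPoint ν γ y 0 := by
  intro y y' h
  have := congrArg (ℝ ∙ ν)ᗮ.orthogonalProjectionOnto h
  simpa [orthogonalProjection_graphPoint] using this

lemma height_graphPoint (hν : ‖ν‖ = 1) (y : (ℝ ∙ ν)ᗮ) (s : ℝ) :
    height ν γ (graphPoint ν γ y s) = s := by
  rw [height, orthogonalProjection_graphPoint, graphPoint, inner_add_right,
    inner_orthogonal_eq_zero, inner_smul_right, real_inner_self_eq_norm_sq, hν]
  ring

lemma graphPoint_height (hν : ‖ν‖ = 1) (x : E) :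
    graphPoint ν γ ((ℝ ∙ ν)ᗮ.orthogonalProjectionOnto x) (height ν γ x) = x := by
  have h := (ℝ ∙ ν).starProjection_add_starProjection_orthogonal x
  rw [Submodule.starProjection_unit_singleton ℝ hν] at h
  rw [graphPoint, height]
  simp only [sub_add_cancel]
  rw [add_comm]
  exact h

lemma height_add_smul (hν : ‖ν‖ = 1) (x : E) (t : ℝ) :
    height ν γ (x + t • ν) = height ν γ x + t := by
  have h1 : (ℝ ∙ ν)ᗮ.orthogonalProjectionOnto (t • ν) = 0 := by
    rw [Submodule.orthogonalProjectionOnto_eq_zero_iff]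
    exact Submodule.le_orthogonal_orthogonal _ (Submodule.smul_mem _ _
      (Submodule.mem_span_singleton_self ν))
  rw [height, height, map_add, h1, inner_add_right, inner_smul_right,
    real_inner_self_eq_norm_sq, hν]
  simp
  ring

variable [FiniteDimensional ℝ E]

lemma fderiv_height_apply_direction (hν : ‖ν‖ = 1) (hγ : ContDiff ℝ 1 γ) (x : E) :
    fderiv ℝ (height ν γ) x ν = 1 := by
  have h1 : HasFDerivAt (height ν γ) (fderiv ℝ (height ν γ) x) x :=
    ((contDiff_height hγ).differentiable one_ne_zero x).hasFDerivAt
  have h2 : HasDerivAt (fun t : ℝ ↦ height ν γ (x + t • ν)) (fderiv ℝ (height ν γ) x ν) 0 := by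
    have h3 : HasDerivAt (fun t : ℝ ↦ x + t • ν) ν 0 := by
      simpa using ((hasDerivAt_id (0 : ℝ)).smul_const ν).const_add x
    exact HasFDerivAt.comp_hasDerivAt (0 : ℝ) (by simpa using h1) h3
  simp_rw [height_add_smul hν] at h2
  exact h2.unique ((hasDerivAt_id (0 : ℝ)).const_add _)

lemma gradient_height_ne_zero (hν : ‖ν‖ = 1) (hγ : ContDiff ℝ 1 γ) (x : E) :
    gradient (height ν γ) x ≠ 0 := by
  intro h
  have h1 := fderiv_height_apply_direction hν hγ x
  rw [← inner_gradient_left, h] at h1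
  simp at h1

end Height

section Sign

variable {E : Type*} [NormedAddCommGroup E] [NormedSpace ℝ E]

lemma eventually_pos_of_fderiv_pos {ψ : E → ℝ} {x v : E} (hψ : DifferentiableAt ℝ ψ x)
    (h0 : ψ x = 0) (hv : 0 < fderiv ℝ ψ x v) : ∀ᶠ t : ℝ in 𝓝[>] 0, 0 < ψ (x + t • v) := by
  have h2 : HasDerivAt (fun t : ℝ ↦ ψ (x + t • v)) (fderiv ℝ ψ x v) 0 := by
    have h3 : HasDerivAt (fun t : ℝ ↦ x + t • v) v 0 := by
      simpa using ((hasDerivAt_id (0 : ℝ)).smul_const v).const_add x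
    exact HasFDerivAt.comp_hasDerivAt (0 : ℝ) (by simpa using hψ.hasFDerivAt) h3
  have h4 := eventually_nhdsWithin_sign_eq_of_deriv_pos (f := fun t : ℝ ↦ ψ (x + t • v))
    (x₀ := 0) (by rw [h2.deriv]; exact hv) (by simpa using h0)
  filter_upwards [nhdsWithin_le_nhds h4, self_mem_nhdsWithin] with t ht ht0
  have : SignType.sign (t - 0) = 1 := by simpa [sign_eq_one_iff] using ht0
  rw [this] at ht
  exact sign_eq_one_iff.1 ht

lemma tendsto_add_smul_nhdsGT (x v : E) :
    Filter.Tendsto (fun t : ℝ ↦ x + t • v) (𝓝[>] 0) (𝓝 x) := by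
  have : Continuous fun t : ℝ ↦ x + t • v := by fun_prop
  simpa using (this.tendsto 0).mono_left nhdsWithin_le_nhds

end Sign

variable {d : ℕ} {Ω : Set (Space d)}

/-- Outward unit normals are unique: if two of them differed, then moving from the boundary point
along their difference would lead into `Ω` according to one defining function and out of `Ω`
according to the other. -/
lemma IsOutwardUnitNormal.unique {x n n' : Space d} (h : IsOutwardUnitNormal Ω x n)
    (h' : IsOutwardUnitNormal Ω x n') : n = n' := by
  obtain ⟨ψ, hψ, h0, hg, hΩ, rfl⟩ := h
  obtain ⟨ψ', hψ', h0', hg', hΩ', rfl⟩ := h'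
  by_contra hne
  set n := ‖gradient ψ x‖⁻¹ • gradient ψ x with hn
  set n' := ‖gradient ψ' x‖⁻¹ • gradient ψ' x with hn'
  have hn1 : ‖n‖ = 1 := norm_smul_inv_norm (𝕜 := ℝ) hg
  have hn1' : ‖n'‖ = 1 := norm_smul_inv_norm (𝕜 := ℝ) hg'
  have hlt : inner ℝ n n' < 1 := inner_lt_one_iff_real_of_norm_eq_one hn1 hn1' |>.2 hne
  have e : gradient ψ x = ‖gradient ψ x‖ • n := by
    rw [hn, smul_smul, mul_inv_cancel₀ (norm_ne_zero_iff.2 hg), one_smul]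
  have e' : gradient ψ' x = ‖gradient ψ' x‖ • n' := by
    rw [hn', smul_smul, mul_inv_cancel₀ (norm_ne_zero_iff.2 hg'), one_smul]
  have hd : DifferentiableAt ℝ ψ x := hψ.differentiableAt one_ne_zero
  have hd' : DifferentiableAt ℝ ψ' x := hψ'.differentiableAt one_ne_zero
  have p1 : 0 < fderiv ℝ (-ψ) x (n' - n) := by
    rw [fderiv_neg, neg_apply, ← inner_gradient_left, e, inner_smul_left,
      inner_sub_right, real_inner_self_eq_norm_sq, hn1]
    have := norm_pos_iff.2 hg
    simp only [conj_trivial]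
    nlinarith
  have p2 : 0 < fderiv ℝ ψ' x (n' - n) := by
    rw [← inner_gradient_left, e', inner_smul_left,
      inner_sub_right, real_inner_self_eq_norm_sq, hn1', real_inner_comm]
    have := norm_pos_iff.2 hg'
    simp only [conj_trivial]
    nlinarith
  have a1 := eventually_pos_of_fderiv_pos hd.neg (by simp [h0]) p1
  have a2 := eventually_pos_of_fderiv_pos hd' h0' p2
  have a3 := (tendsto_add_smul_nhdsGT x (n' - n)).eventually hΩ
  have a4 := (tendsto_add_smul_nhdsGT x (n' - n)).eventually hΩ'
  obtain ⟨t, b1, b2, b3, b4⟩ := (a1.and (a2.and (a3.and a4))).exists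
  have : ψ (x + t • (n' - n)) < 0 := by simpa using b1
  have := b4.1 (b3.2 this)
  linarith

lemma IsOutwardUnitNormal.outwardNormal_eq {x n : Space d} (h : IsOutwardUnitNormal Ω x n) :
    outwardNormal Ω x = n := by
  have hex : ∃ n, IsOutwardUnitNormal Ω x n := ⟨n, h⟩
  rw [outwardNormal, dif_pos hex]
  exact hex.choose_spec.unique h

section Chart

variable {ν : Space d} {γ : (ℝ ∙ ν)ᗮ → ℝ} {U : Set (Space d)}

/-- `Ω` is the epigraph of `γ` in direction `ν` inside the open set `U`. -/
structure IsGraphChart (Ω U : Set (Space d)) (ν : Space d) (γ : (ℝ ∙ ν)ᗮ → ℝ) : Prop where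
  norm_eq_one : ‖ν‖ = 1
  contDiff : ContDiff ℝ 1 γ
  isOpen : IsOpen U
  mem_iff : ∀ y ∈ U, (y ∈ Ω ↔ 0 < height ν γ y)

lemma HasC1Boundary.exists_isGraphChart (hΩ : HasC1Boundary Ω) {x : Space d}
    (hx : x ∈ frontier Ω) : ∃ ν γ U, x ∈ U ∧ IsGraphChart Ω U ν γ := by
  obtain ⟨ν, γ, hν, hγ, h⟩ := hΩ x hx
  obtain ⟨U, hU, hUo, hxU⟩ := eventually_nhds_iff.1 h
  exact ⟨ν, γ, U, hxU, hν, hγ, hUo, fun y hy ↦ by rw [hU y hy, height, sub_pos]⟩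

namespace IsGraphChart

lemma continuous_height (hc : IsGraphChart Ω U ν γ) : Continuous (height ν γ) :=
  (contDiff_height hc.contDiff).continuous

lemma mem_closure_iff (hc : IsGraphChart Ω U ν γ) {y : Space d} (hy : y ∈ U) :
    y ∈ closure Ω ↔ 0 ≤ height ν γ y := by
  constructor
  · intro h
    by_contra! hlt
    have h1 : ∀ᶠ z in 𝓝 y, height ν γ z < 0 :=
      hc.continuous_height.continuousAt.eventually_lt continuousAt_const hlt
    obtain ⟨z, hzΩ, hz, hzU⟩ := (mem_closure_iff_frequently.1 h).and_eventually
      (h1.and (hc.isOpen.mem_nhds hy)) |>.exists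
    exact absurd ((hc.mem_iff z hzU).1 hzΩ) hz.not_gt
  · intro h
    refine mem_closure_of_tendsto (tendsto_add_smul_nhdsGT y ν) ?_
    filter_upwards [(tendsto_add_smul_nhdsGT y ν).eventually (hc.isOpen.mem_nhds hy),
      self_mem_nhdsWithin] with t ht ht0
    rw [hc.mem_iff _ ht, height_add_smul hc.norm_eq_one]
    have : 0 < t := ht0
    linarith

lemma mem_frontier_iff (hc : IsGraphChart Ω U ν γ) (hΩ : IsOpen Ω) {y : Space d} (hy : y ∈ U) :
    y ∈ frontier Ω ↔ height ν γ y = 0 := by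
  rw [hΩ.frontier_eq, mem_sdiff, hc.mem_closure_iff hy, hc.mem_iff y hy, not_lt, le_antisymm_iff,
    and_comm]

/-- In a graph chart the outward normal is the downward normalized gradient of the height. -/
lemma outwardNormal_eq (hc : IsGraphChart Ω U ν γ) {x : Space d} (hx : x ∈ U)
    (h0 : height ν γ x = 0) :
    outwardNormal Ω x = -(‖gradient (height ν γ) x‖⁻¹ • gradient (height ν γ) x) := by
  apply IsOutwardUnitNormal.outwardNormal_eq
  have hd := (contDiff_height hc.contDiff).contDiffAt (x := x)
  have hg : gradient (-height ν γ) x = -gradient (height ν γ) x := by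
    simp [gradient, fderiv_neg]
  refine ⟨-height ν γ, hd.neg, by simp [h0], ?_, ?_, ?_⟩
  · rw [hg]
    simpa using gradient_height_ne_zero hc.norm_eq_one hc.contDiff x
  · filter_upwards [hc.isOpen.mem_nhds hx] with y hy
    rw [hc.mem_iff y hy]
    simp
  · rw [hg]
    simp

lemma uniqueDiffWithinAt (hc : IsGraphChart Ω U ν γ) {x : Space d} (hx : x ∈ U)
    (h0 : height ν γ x = 0) : UniqueDiffWithinAt ℝ Ω x := by
  refine ⟨?_, (hc.mem_closure_iff hx).2 h0.ge⟩
  -- the tangent cone contains the open half-space of directions in which the height increases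
  have key : ∀ v : Space d, 0 < fderiv ℝ (height ν γ) x v → v ∈ tangentConeAt ℝ Ω x := by
    intro v hv
    refine mem_tangentConeAt_of_add_smul_mem (l := 𝓝[>] (0 : ℝ)) (c := id) ?_ ?_
    · exact Filter.tendsto_id.mono_left (nhdsWithin_mono _ fun t (ht : 0 < t) ↦ ht.ne')
    · filter_upwards [eventually_pos_of_fderiv_pos
        ((contDiff_height hc.contDiff).differentiable one_ne_zero x) h0 hv,
        (tendsto_add_smul_nhdsGT x v).eventually (hc.isOpen.mem_nhds hx)] with t ht htU
      exact (hc.mem_iff _ htU).2 ht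
  have hν1 := fderiv_height_apply_direction hc.norm_eq_one hc.contDiff x
  have htop : Submodule.span ℝ (tangentConeAt ℝ Ω x) = ⊤ := by
    rw [eq_top_iff]
    intro v _
    set a := 1 + |fderiv ℝ (height ν γ) x v| with ha
    have e : v = (v + a • ν) - a • ν := by abel
    rw [e]
    refine Submodule.sub_mem _ (Submodule.subset_span (key _ ?_))
      (Submodule.smul_mem _ _ (Submodule.subset_span (key _ ?_)))
    · rw [map_add, map_smul, hν1, smul_eq_mul, mul_one]
      have := neg_abs_le (fderiv ℝ (height ν γ) x v)
      linarith
    · rw [hν1]; exact one_pos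
  rw [htop]
  exact dense_univ

end IsGraphChart

end Chart

lemma HasC1Boundary.uniqueDiffOn_closure (hΩ : HasC1Boundary Ω) (ho : IsOpen Ω) :
    UniqueDiffOn ℝ (closure Ω) := by
  intro x hx
  by_cases h : x ∈ Ω
  · exact (ho.uniqueDiffWithinAt h).mono subset_closure
  · have hf : x ∈ frontier Ω := by rw [ho.frontier_eq]; exact ⟨hx, h⟩
    obtain ⟨ν, γ, U, hxU, hc⟩ := hΩ.exists_isGraphChart hf
    exact (hc.uniqueDiffWithinAt hxU ((hc.mem_frontier_iff ho hxU).1 hf)).mono subset_closure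

end NeumannLS

/-! ### Surface measure in a graph chart -/

namespace NeumannLS
section
variable {E : Type*} [NormedAddCommGroup E] [InnerProductSpace ℝ E] [FiniteDimensional ℝ E]
  [MeasurableSpace E] [BorelSpace E] {ν : E} {γ : (ℝ ∙ ν)ᗮ → ℝ}

lemma measurePreserving_graphPoint (hν : ‖ν‖ = 1) (hγ : Continuous γ) :
    MeasurePreserving (fun p : (ℝ ∙ ν)ᗮ × ℝ ↦ graphPoint ν γ p.1 p.2)
      (volume.prod volume) volume := by
  have h1 : MeasurePreserving (fun p : (ℝ ∙ ν)ᗮ × ℝ ↦ (p.1, p.2 + γ p.1))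
      (volume.prod volume) (volume.prod volume) := by
    refine (MeasurePreserving.id volume).skew_product (g := fun y s ↦ s + γ y) ?_ ?_
    · fun_prop
    · exact Filter.Eventually.of_forall fun y ↦ (measurePreserving_add_right volume (γ y)).map_eq
  have h2 : MeasurePreserving (Prod.swap : (ℝ ∙ ν)ᗮ × ℝ → ℝ × (ℝ ∙ ν)ᗮ)
      (volume.prod volume) (volume.prod volume) := Measure.measurePreserving_swap
  have h3 : MeasurePreserving (Prod.map (LinearIsometryEquiv.toSpanUnitSingleton ν hν) id :
      ℝ × (ℝ ∙ ν)ᗮ → (ℝ ∙ ν) × (ℝ ∙ ν)ᗮ) (volume.prod volume) (volume.prod volume) :=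
    (LinearIsometryEquiv.measurePreserving _).prod (MeasurePreserving.id _)
  have h4 := ((ℝ ∙ ν).measurePreserving_measurableEquivProd (0 : E)).symm
  rw [InnerProductSpace.euclideanHausdorffMeasure_eq_volume] at h4
  have h5 := ((h4.comp h3).comp h2).comp h1
  have h6 : (fun p : (ℝ ∙ ν)ᗮ × ℝ ↦ graphPoint ν γ p.1 p.2) =
      ((((ℝ ∙ ν).measurableEquivProd (0 : E)).symm ∘
        Prod.map (LinearIsometryEquiv.toSpanUnitSingleton ν hν) id) ∘ Prod.swap) ∘
        fun p ↦ (p.1, p.2 + γ p.1) := by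
    funext p
    simp [graphPoint, add_comm]
  rw [h6]
  exact h5

lemma measurableEmbedding_graphPoint_zero (hγ : Continuous γ) :
    MeasurableEmbedding fun y : (ℝ ∙ ν)ᗮ ↦ graphPoint ν γ y 0 :=
  ((continuous_graphPoint hγ).comp (by fun_prop : Continuous fun y ↦ (y, (0 : ℝ)))
    ).measurableEmbedding graphPoint_zero_injective

end

section Hausdorff
variable {X Y : Type*} [MetricSpace X] [MeasurableSpace X] [BorelSpace X]
  [MetricSpace Y] [MeasurableSpace Y] [BorelSpace Y]

lemma euclideanHausdorffMeasure_image_le {f : X → Y} {K : NNReal} {s : Set X}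
    (hf : LipschitzOnWith K f s) (n : ℕ) :
    μHE[n] (f '' s) ≤ (K : ℝ≥0∞) ^ n * μHE[n] s := by
  simp_rw [Measure.euclideanHausdorffMeasure_def, Measure.smul_apply]
  have h := hf.hausdorffMeasure_image_le (d := (n : ℝ)) (by positivity)
  rw [ENNReal.rpow_natCast] at h
  rw [ENNReal.smul_def, ENNReal.smul_def, smul_eq_mul, smul_eq_mul, mul_left_comm]
  gcongr

end Hausdorff

variable {d : ℕ} {Ω U : Set (Space d)} {ν : Space d} {γ : (ℝ ∙ ν)ᗮ → ℝ}

lemma finrank_orthogonal_direction (hν : ‖ν‖ = 1) : Module.finrank ℝ (ℝ ∙ ν)ᗮ = d - 1 := by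
  have h1 := (ℝ ∙ ν).finrank_add_finrank_orthogonal
  rw [finrank_span_singleton (by rintro rfl; simp at hν), finrank_euclideanSpace_fin] at h1
  omega

lemma euclideanHausdorffMeasure_orthogonal_eq_volume (hν : ‖ν‖ = 1) :
    (μHE[d - 1] : Measure (ℝ ∙ ν)ᗮ) = volume := by
  rw [← InnerProductSpace.euclideanHausdorffMeasure_eq_volume, finrank_orthogonal_direction hν]

/-- Orthogonal projection does not increase the surface measure, so that the base measure, carried
to the part of the boundary inside a graph chart, is at most the surface measure. -/
lemma IsGraphChart.map_graphPoint_le (hc : IsGraphChart Ω U ν γ) (hΩ : IsOpen Ω) :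
    ((volume : Measure (ℝ ∙ ν)ᗮ).restrict {y | graphPoint ν γ y 0 ∈ U}).map
      (fun y ↦ graphPoint ν γ y 0) ≤ surfaceMeasure Ω := by
  have hme := measurableEmbedding_graphPoint_zero (ν := ν) hc.contDiff.continuous
  refine Measure.le_iff.2 fun s hs ↦ ?_
  have hU : MeasurableSet {y : (ℝ ∙ ν)ᗮ | graphPoint ν γ y 0 ∈ U} :=
    hme.measurable hc.isOpen.measurableSet
  rw [hme.map_apply, Measure.restrict_apply (hme.measurable hs), surfaceMeasure,
    Measure.restrict_apply hs, ← euclideanHausdorffMeasure_orthogonal_eq_volume hc.norm_eq_one]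
  have hL : LipschitzOnWith 1 ((ℝ ∙ ν)ᗮ.orthogonalProjectionOnto : Space d → (ℝ ∙ ν)ᗮ)
      (s ∩ frontier Ω) := by
    refine LipschitzWith.lipschitzOnWith ?_
    exact ((ℝ ∙ ν)ᗮ.orthogonalProjectionOnto.lipschitz).weaken
      (Submodule.orthogonalProjectionOnto_norm_le _)
  refine le_trans (measure_mono ?_)
    ((euclideanHausdorffMeasure_image_le hL (d - 1)).trans (by simp))
  rintro y ⟨hys, hyU⟩
  exact ⟨graphPoint ν γ y 0, ⟨hys, (hc.mem_frontier_iff hΩ hyU).2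
    (height_graphPoint hc.norm_eq_one y 0)⟩, orthogonalProjection_graphPoint y 0⟩

/-- A graph chart around a boundary point carries positive surface measure. -/
lemma IsGraphChart.surfaceMeasure_univ_ne_zero (hc : IsGraphChart Ω U ν γ) (hΩ : IsOpen Ω)
    {x : Space d} (hx : x ∈ U) (h0 : height ν γ x = 0) : surfaceMeasure Ω univ ≠ 0 := by
  have hme := measurableEmbedding_graphPoint_zero (ν := ν) hc.contDiff.continuous
  have h1 := hc.map_graphPoint_le hΩ univ
  rw [hme.map_apply, preimage_univ, Measure.restrict_apply_univ] at h1
  have hopen : IsOpen {y : (ℝ ∙ ν)ᗮ | graphPoint ν γ y 0 ∈ U} :=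
    hc.isOpen.preimage ((continuous_graphPoint hc.contDiff.continuous).comp
      (by fun_prop : Continuous fun y ↦ (y, (0 : ℝ))))
  have hne : {y : (ℝ ∙ ν)ᗮ | graphPoint ν γ y 0 ∈ U}.Nonempty := by
    refine ⟨(ℝ ∙ ν)ᗮ.orthogonalProjectionOnto x, ?_⟩
    have := graphPoint_height (γ := γ) hc.norm_eq_one x
    rw [h0] at this
    simpa [this] using hx
  exact ((hopen.measure_pos volume hne).trans_le h1).ne'

/-- A `C¹` graph has locally finite surface measure, since its parametrization is locally
Lipschitz. -/
lemma IsGraphChart.exists_surfaceMeasure_lt_top (hc : IsGraphChart Ω U ν γ) (hΩ : IsOpen Ω)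
    {x : Space d} (hx : x ∈ U) : ∃ V ∈ 𝓝 x, surfaceMeasure Ω V < ⊤ := by
  set P : Space d → (ℝ ∙ ν)ᗮ := (ℝ ∙ ν)ᗮ.orthogonalProjectionOnto
  have hsm : ContDiff ℝ 1 fun y : (ℝ ∙ ν)ᗮ ↦ graphPoint ν γ y 0 := by
    unfold graphPoint
    have := hc.contDiff
    exact ((ℝ ∙ ν)ᗮ.subtypeL.contDiff).add ((contDiff_const.add this).smul contDiff_const)
  obtain ⟨K, t, ht, hK⟩ := hsm.contDiffAt.exists_lipschitzOnWith (x := P x)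
  obtain ⟨t', ht', hfin⟩ := (volume : Measure (ℝ ∙ ν)ᗮ).finiteAt_nhds (P x)
  have hPc : Continuous P := (ℝ ∙ ν)ᗮ.orthogonalProjectionOnto.continuous
  refine ⟨U ∩ P ⁻¹' (t ∩ t'), Filter.inter_mem (hc.isOpen.mem_nhds hx)
    (hPc.continuousAt.preimage_mem_nhds (Filter.inter_mem ht ht')), ?_⟩
  have h1 : surfaceMeasure Ω (U ∩ P ⁻¹' (t ∩ t')) ≤
      μHE[d - 1] ((fun y : (ℝ ∙ ν)ᗮ ↦ graphPoint ν γ y 0) '' (t ∩ t')) := by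
    rw [surfaceMeasure, Measure.restrict_apply' isClosed_frontier.measurableSet]
    refine measure_mono ?_
    rintro z ⟨⟨hzU, hz⟩, hzf⟩
    refine ⟨P z, hz, ?_⟩
    have := graphPoint_height (γ := γ) hc.norm_eq_one z
    rwa [(hc.mem_frontier_iff hΩ hzU).1 hzf] at this
  refine h1.trans_lt ((euclideanHausdorffMeasure_image_le (hK.mono inter_subset_left) _).trans_lt ?_)
  rw [euclideanHausdorffMeasure_orthogonal_eq_volume hc.norm_eq_one]
  exact ENNReal.mul_lt_top (by simp) ((measure_mono inter_subset_right).trans_lt hfin)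

lemma HasC1Boundary.surfaceMeasure_univ_lt_top (hΩ : HasC1Boundary Ω) (ho : IsOpen Ω)
    (hb : Bornology.IsBounded Ω) : surfaceMeasure Ω univ < ⊤ := by
  have hcpt : IsCompact (frontier Ω) :=
    hb.isCompact_closure.of_isClosed_subset isClosed_frontier frontier_subset_closure
  have h1 : surfaceMeasure Ω (frontier Ω) < ⊤ := by
    refine hcpt.measure_lt_top_of_nhdsWithin fun x hx ↦ ?_
    obtain ⟨ν, γ, U, hxU, hc⟩ := hΩ.exists_isGraphChart hx
    obtain ⟨V, hV, hfin⟩ := hc.exists_surfaceMeasure_lt_top ho hxU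
    exact ⟨V, nhdsWithin_le_nhds hV, hfin⟩
  rwa [surfaceMeasure, Measure.restrict_apply_self, ← Measure.restrict_apply_univ] at h1

lemma frontier_nonempty (hd : 0 < d) (hne : Ω.Nonempty) (hb : Bornology.IsBounded Ω) :
    (frontier Ω).Nonempty := by
  have : Nonempty (Fin d) := ⟨⟨0, hd⟩⟩
  rw [nonempty_frontier_iff]
  refine ⟨hne, ?_⟩
  rintro rfl
  exact NormedSpace.unbounded_univ ℝ (Space d) hb

lemma HasC1Boundary.surfaceMeasure_univ_ne_zero (hΩ : HasC1Boundary Ω) (hd : 0 < d)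
    (ho : IsOpen Ω) (hne : Ω.Nonempty) (hb : Bornology.IsBounded Ω) :
    surfaceMeasure Ω univ ≠ 0 := by
  obtain ⟨x, hx⟩ := frontier_nonempty hd hne hb
  obtain ⟨ν, γ, U, hxU, hc⟩ := hΩ.exists_isGraphChart hx
  exact hc.surfaceMeasure_univ_ne_zero ho hxU ((hc.mem_frontier_iff ho hxU).1 hx)

end NeumannLS

/-! ### Test functions, mollification and the Laplacian -/

namespace NeumannLS
section TestFunctions
variable {E F : Type*} [NormedAddCommGroup E] [NormedAddCommGroup F]

lemma continuous_of_eq_zero_off {Ω K : Set E} (hΩ : IsOpen Ω) (hK : IsClosed K) (hKΩ : K ⊆ Ω)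
    {f : E → F} (hf : ContinuousOn f Ω) (h0 : ∀ x ∉ K, f x = 0) : Continuous f := by
  refine continuous_iff_continuousAt.2 fun x ↦ ?_
  by_cases hx : x ∈ K
  · exact hf.continuousAt (hΩ.mem_nhds (hKΩ hx))
  · have : f =ᶠ[𝓝 x] fun _ ↦ 0 := by
      filter_upwards [hK.isOpen_compl.mem_nhds hx] with y hy using h0 y hy
    exact continuousAt_const.congr this.symm

lemma integrable_mul_of_hasCompactSupport [MeasurableSpace E] [BorelSpace E] {μ : Measure E}
    {φ h : E → ℝ} (hφ : Continuous φ)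
    (hcs : HasCompactSupport φ) (hh : Integrable h μ) : Integrable (fun x ↦ h x * φ x) μ := by
  obtain ⟨M, hM⟩ := hcs.exists_bound_of_continuous hφ
  exact hh.mul_bdd (c := M) hφ.aestronglyMeasurable (Filter.Eventually.of_forall hM)

variable [NormedSpace ℝ E] [NormedSpace ℝ F]

lemma contDiff_of_eq_zero_off {Ω K : Set E} {n : WithTop ℕ∞} (hΩ : IsOpen Ω) (hK : IsClosed K)
    (hKΩ : K ⊆ Ω) {f : E → F} (hf : ContDiffOn ℝ n f Ω) (h0 : ∀ x ∉ K, f x = 0) :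
    ContDiff ℝ n f := by
  refine contDiff_iff_contDiffAt.2 fun x ↦ ?_
  by_cases hx : x ∈ K
  · exact hf.contDiffAt (hΩ.mem_nhds (hKΩ hx))
  · have : f =ᶠ[𝓝 x] fun _ ↦ 0 := by
      filter_upwards [hK.isOpen_compl.mem_nhds hx] with y hy using h0 y hy
    exact contDiffAt_const.congr_of_eventuallyEq this

lemma fderiv_eq_zero_of_notMem_tsupport {f : E → F} {x : E} (hx : x ∉ tsupport f) :
    fderiv ℝ f x = 0 :=
  image_eq_zero_of_notMem_tsupport fun h ↦ hx (tsupport_fderiv_subset ℝ h)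

variable [FiniteDimensional ℝ E] [MeasurableSpace E] [BorelSpace E]

lemma integrable_fderiv_apply {μ : Measure E} {φ : E → ℝ} {G : E → E} (hφ : ContDiff ℝ 1 φ)
    (hcs : HasCompactSupport φ) (hG : Integrable G μ) :
    Integrable (fun x ↦ fderiv ℝ φ x (G x)) μ := by
  have hcont := hφ.continuous_fderiv one_ne_zero
  obtain ⟨M, hM⟩ := (hcs.fderiv ℝ).exists_bound_of_continuous hcont
  have hm : AEStronglyMeasurable (fun x ↦ fderiv ℝ φ x (G x)) μ :=
    (ContinuousLinearMap.id ℝ (E →L[ℝ] ℝ)).aestronglyMeasurable_comp₂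
      hcont.aestronglyMeasurable hG.aestronglyMeasurable
  refine (hG.norm.const_mul M).mono' hm (Filter.Eventually.of_forall fun x ↦ ?_)
  exact ((fderiv ℝ φ x).le_opNorm _).trans (by gcongr; exact hM x)

/-- A weak equation against smooth compactly supported test functions extends to test functions
of class `C¹`, by mollification. -/
lemma weak_eq_of_contDiff_one {Ω : Set E} (hΩ : IsOpen Ω) {μ : Measure E} {G : E → E} {h : E → ℝ}
    (hG : Integrable G μ) (hh : Integrable h μ)
    (H : ∀ φ : E → ℝ, ContDiff ℝ ∞ φ → HasCompactSupport φ → tsupport φ ⊆ Ω →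
      ∫ x, (fderiv ℝ φ x (G x) - h x * φ x) ∂μ = 0)
    {φ : E → ℝ} (hφ : ContDiff ℝ 1 φ) (hcs : HasCompactSupport φ) (hsub : tsupport φ ⊆ Ω) :
    ∫ x, (fderiv ℝ φ x (G x) - h x * φ x) ∂μ = 0 := by
  obtain ⟨ε, hε, hεΩ⟩ := hcs.isCompact.exists_cthickening_subset_open hΩ hsub
  have hr (n : ℕ) : 0 < ε / ((n : ℝ) + 1) := by positivity
  let ρ (n : ℕ) : ContDiffBump (0 : E) :=
    ⟨ε / ((n : ℝ) + 1) / 2, ε / ((n : ℝ) + 1), half_pos (hr n), half_lt_self (hr n)⟩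
  have hρ0 : Filter.Tendsto (fun n ↦ (ρ n).rOut) Filter.atTop (𝓝 0) :=
    tendsto_const_div_atTop_nhds_zero_nat ε |>.comp (Filter.tendsto_add_atTop_nat 1) |>.congr
      fun n ↦ by simp [ρ]
  let η : Measure E := Measure.addHaar
  let ψ (n : ℕ) : E → ℝ := convolution ((ρ n).normed η) φ (ContinuousLinearMap.lsmul ℝ ℝ) η
  have hfd (n : ℕ) (x : E) : fderiv ℝ (ψ n) x =
      convolution ((ρ n).normed η) (fderiv ℝ φ) (ContinuousLinearMap.lsmul ℝ ℝ) η x := by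
    rw [(hcs.hasFDerivAt_convolution_right (ContinuousLinearMap.lsmul ℝ ℝ)
      ((ρ n).continuous_normed.locallyIntegrable) hφ x).fderiv]
    rfl
  have hφc := hφ.continuous
  have hdc := hφ.continuous_fderiv one_ne_zero
  obtain ⟨M, hM⟩ := hcs.exists_bound_of_continuous hφc
  obtain ⟨M', hM'⟩ := (hcs.fderiv ℝ).exists_bound_of_continuous hdc
  have hψb (n : ℕ) (x : E) : ‖ψ n x‖ ≤ 3 * M := by
    have h1 : dist (ψ n x) (φ x) ≤ 2 * M :=
      (ρ n).dist_normed_convolution_le hφc.aestronglyMeasurable fun y _ ↦ by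
        rw [dist_eq_norm]
        linarith [norm_sub_le (φ y) (φ x), hM x, hM y]
    rw [dist_eq_norm] at h1
    linarith [norm_sub_norm_le (ψ n x) (φ x), hM x]
  have hψb' (n : ℕ) (x : E) : ‖fderiv ℝ (ψ n) x‖ ≤ 3 * M' := by
    have h1 : dist (fderiv ℝ (ψ n) x) (fderiv ℝ φ x) ≤ 2 * M' := by
      rw [hfd]
      refine (ρ n).dist_normed_convolution_le hdc.aestronglyMeasurable fun y _ ↦ ?_
      rw [dist_eq_norm]
      linarith [norm_sub_le (fderiv ℝ φ y) (fderiv ℝ φ x), hM' x, hM' y]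
    rw [dist_eq_norm] at h1
    linarith [norm_sub_norm_le (fderiv ℝ (ψ n) x) (fderiv ℝ φ x), hM' x]
  have hsm (n : ℕ) : ContDiff ℝ ∞ (ψ n) :=
    (ρ n).hasCompactSupport_normed.contDiff_convolution_left _ (ρ n).contDiff_normed
      hφc.locallyIntegrable
  have hts (n : ℕ) : tsupport (ψ n) ⊆ Metric.cthickening ε (tsupport φ) := by
    refine closure_minimal ?_ Metric.isClosed_cthickening
    refine (support_convolution_subset_swap _).trans ?_
    rintro _ ⟨a, ha, b, hb, rfl⟩
    rw [(ρ n).support_normed_eq, mem_ball_zero_iff] at hb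
    refine Metric.mem_cthickening_of_dist_le _ a _ _ (subset_tsupport _ ha) ?_
    have h2 : (ρ n).rOut ≤ ε := div_le_self hε.le (by simp)
    simpa [dist_eq_norm] using hb.le.trans h2
  have hcs' (n : ℕ) : HasCompactSupport (ψ n) :=
    hcs.isCompact.cthickening.of_isClosed_subset (isClosed_tsupport _) (hts n)
  have hlim : Filter.Tendsto (fun n ↦ ∫ x, (fderiv ℝ (ψ n) x (G x) - h x * ψ n x) ∂μ)
      Filter.atTop (𝓝 (∫ x, (fderiv ℝ φ x (G x) - h x * φ x) ∂μ)) := by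
    refine tendsto_integral_of_dominated_convergence
      (fun x ↦ 3 * M' * ‖G x‖ + ‖h x‖ * (3 * M)) ?_ ?_ ?_ ?_
    · exact fun n ↦
        ((integrable_fderiv_apply ((hsm n).of_le (by norm_cast)) (hcs' n) hG).sub
        (integrable_mul_of_hasCompactSupport (hsm n).continuous (hcs' n) hh)).aestronglyMeasurable
    · exact (hG.norm.const_mul _).add (hh.norm.mul_const _)
    · refine fun n ↦ Filter.Eventually.of_forall fun x ↦ ?_
      refine (norm_sub_le _ _).trans (add_le_add ?_ ?_)
      · exact ((fderiv ℝ (ψ n) x).le_opNorm _).trans (by gcongr; exact hψb' n x)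
      · rw [norm_mul]
        gcongr
        exact hψb n x
    · refine Filter.Eventually.of_forall fun x ↦ Filter.Tendsto.sub ?_ (Filter.Tendsto.mul
        tendsto_const_nhds ?_)
      · have h1 : Filter.Tendsto (fun n ↦ fderiv ℝ (ψ n) x) Filter.atTop (𝓝 (fderiv ℝ φ x)) := by
          simp_rw [hfd]
          exact ContDiffBump.convolution_tendsto_right_of_continuous hρ0 hdc x
        exact ((ContinuousLinearMap.apply ℝ ℝ (G x)).continuous.tendsto _).comp h1
      · exact ContDiffBump.convolution_tendsto_right_of_continuous hρ0 hφc x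
  refine tendsto_nhds_unique hlim (Filter.Tendsto.congr (fun n ↦ ?_) tendsto_const_nhds)
  exact (H (ψ n) (hsm n) (hcs' n) ((hts n).trans hεΩ)).symm

lemma integral_fderiv_apply_eq_zero {μ : Measure E} [μ.IsAddHaarMeasure] {φ : E → ℝ}
    (hφ : ContDiff ℝ 1 φ) (hcs : HasCompactSupport φ) (v : E) :
    ∫ x, fderiv ℝ φ x v ∂μ = 0 := by
  have h := integral_mul_fderiv_eq_neg_fderiv_mul_of_integrable (𝕜 := ℝ) (μ := μ)
    (f := fun _ ↦ (1 : ℝ)) (g := φ) (v := v) (by simp) (by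
      simpa using ((hφ.continuous_fderiv one_ne_zero).clm_apply
        continuous_const).integrable_of_hasCompactSupport (hcs.fderiv_apply ℝ v))
    (by simpa using hφ.continuous.integrable_of_hasCompactSupport hcs)
    (by fun_prop) (fun x _ ↦ hφ.differentiable one_ne_zero x)
  simpa using h

end TestFunctions

section Laplacian
variable {E : Type*} [NormedAddCommGroup E] [InnerProductSpace ℝ E] [FiniteDimensional ℝ E]

lemma laplacian_eq_sum (u : E → ℝ) (x : E) : Laplacian.laplacian u x =
    ∑ i, fderiv ℝ (fderiv ℝ u) x (stdOrthonormalBasis ℝ E i) (stdOrthonormalBasis ℝ E i) := by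
  rw [laplacian_eq_iteratedFDeriv_stdOrthonormalBasis]
  simp [iteratedFDeriv_two_apply]

lemma continuousOn_laplacian {Ω : Set E} (hΩ : IsOpen Ω) {u : E → ℝ} (hu : ContDiffOn ℝ 2 u Ω) :
    ContinuousOn (Laplacian.laplacian u) Ω := by
  have h1 : ContDiffOn ℝ 1 (fderiv ℝ u) Ω := hu.fderiv_of_isOpen hΩ (by norm_num)
  have h2 := h1.continuousOn_fderiv_of_isOpen hΩ le_rfl
  have h3 : Laplacian.laplacian u = fun x ↦ ∑ i, fderiv ℝ (fderiv ℝ u) x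
      (stdOrthonormalBasis ℝ E i) (stdOrthonormalBasis ℝ E i) := funext (laplacian_eq_sum u)
  rw [h3]
  fun_prop

variable [MeasurableSpace E] [BorelSpace E]

/-- Green's first identity for a compactly supported test function. -/
lemma integral_fderiv_gradient {Ω : Set E} (hΩ : IsOpen Ω) {u φ : E → ℝ}
    (hu : ContDiffOn ℝ 2 u Ω) (hφ : ContDiff ℝ ∞ φ) (hcs : HasCompactSupport φ)
    (hsub : tsupport φ ⊆ Ω) :
    ∫ x in Ω, fderiv ℝ φ x (gradient u x) = ∫ x in Ω, -Laplacian.laplacian u x * φ x := by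
  set e := stdOrthonormalBasis ℝ E
  have hφ1 : ContDiff ℝ 1 φ := hφ.of_le (by norm_cast)
  have h1 : ContDiffOn ℝ 1 (fderiv ℝ u) Ω := hu.fderiv_of_isOpen hΩ (by norm_num)
  have h2 := h1.continuousOn_fderiv_of_isOpen hΩ le_rfl
  have hg (i) : ContDiff ℝ 1 fun x ↦ φ x * fderiv ℝ u x (e i) :=
    contDiff_of_eq_zero_off hΩ (isClosed_tsupport φ) hsub
      (hφ1.contDiffOn.mul (h1.clm_apply contDiffOn_const))
      fun x hx ↦ by rw [image_eq_zero_of_notMem_tsupport hx, zero_mul]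
  have hgc (i) : HasCompactSupport fun x ↦ φ x * fderiv ℝ u x (e i) := hcs.mul_right
  have key (x : E) : ∑ i, fderiv ℝ (fun x ↦ φ x * fderiv ℝ u x (e i)) x (e i) =
      fderiv ℝ φ x (gradient u x) + Laplacian.laplacian u x * φ x := by
    by_cases hx : x ∈ tsupport φ
    · have d1 : DifferentiableAt ℝ φ x := hφ1.differentiable one_ne_zero x
      have d2 : DifferentiableAt ℝ (fderiv ℝ u) x :=
        (h1.contDiffAt (hΩ.mem_nhds (hsub hx))).differentiableAt one_ne_zero
      have e1 (i) : fderiv ℝ (fun x ↦ φ x * fderiv ℝ u x (e i)) x (e i) =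
          φ x * fderiv ℝ (fderiv ℝ u) x (e i) (e i) + fderiv ℝ φ x (e i) * fderiv ℝ u x (e i) := by
        rw [fderiv_fun_mul d1 (by fun_prop), fderiv_clm_apply d2 (by fun_prop)]
        simp [mul_comm]
      have e2 : fderiv ℝ φ x (gradient u x) = ∑ i, fderiv ℝ φ x (e i) * fderiv ℝ u x (e i) := by
        conv_lhs => rw [← e.sum_repr (gradient u x)]
        simp only [map_sum, map_smul, smul_eq_mul]
        refine Finset.sum_congr rfl fun i _ ↦ ?_
        rw [e.repr_apply_apply, real_inner_comm, inner_gradient_left, mul_comm]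
      simp_rw [e1]
      rw [Finset.sum_add_distrib, ← Finset.mul_sum, ← laplacian_eq_sum, e2]
      ring
    · rw [fderiv_eq_zero_of_notMem_tsupport hx, image_eq_zero_of_notMem_tsupport hx]
      simp only [zero_apply, mul_zero, add_zero]
      refine Finset.sum_eq_zero fun i _ ↦ ?_
      rw [fderiv_eq_zero_of_notMem_tsupport fun h ↦ hx (tsupport_mul_subset_left h)]
      rfl
  have hzero : ∫ x, (fderiv ℝ φ x (gradient u x) + Laplacian.laplacian u x * φ x) = 0 := by
    simp_rw [← key]
    rw [integral_finsetSum]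
    · exact Finset.sum_eq_zero fun i _ ↦ integral_fderiv_apply_eq_zero (hg i) (hgc i) _
    · exact fun i _ ↦ (((hg i).continuous_fderiv one_ne_zero).clm_apply
        continuous_const).integrable_of_hasCompactSupport ((hgc i).fderiv_apply ℝ _)
  have c1 : Integrable fun x ↦ Laplacian.laplacian u x * φ x := by
    refine Continuous.integrable_of_hasCompactSupport ?_ hcs.mul_left
    exact continuous_of_eq_zero_off hΩ (isClosed_tsupport φ) hsub
      ((continuousOn_laplacian hΩ hu).mul hφ1.continuous.continuousOn)
      fun x hx ↦ by rw [image_eq_zero_of_notMem_tsupport hx, mul_zero]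
  have hgr : ContinuousOn (gradient u) Ω :=
    (toDual ℝ E).symm.continuous.comp_continuousOn h1.continuousOn
  have c2 : Integrable fun x ↦ fderiv ℝ φ x (gradient u x) := by
    refine Continuous.integrable_of_hasCompactSupport ?_
      (hcs.mono' fun x hx ↦ by
        by_contra h
        simp [fderiv_eq_zero_of_notMem_tsupport h] at hx)
    exact continuous_of_eq_zero_off hΩ (isClosed_tsupport φ) hsub
      ((hφ1.continuous_fderiv one_ne_zero).continuousOn.clm_apply hgr)
      fun x hx ↦ by rw [fderiv_eq_zero_of_notMem_tsupport hx]; rfl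
  rw [integral_add c2 c1] at hzero
  rw [setIntegral_eq_integral_of_forall_compl_eq_zero, setIntegral_eq_integral_of_forall_compl_eq_zero]
  · simp_rw [neg_mul]
    rw [integral_neg]
    linarith
  · intro x hx
    rw [image_eq_zero_of_notMem_tsupport fun h ↦ hx (hsub h), mul_zero]
  · intro x hx
    rw [fderiv_eq_zero_of_notMem_tsupport fun h ↦ hx (hsub h)]
    rfl

end Laplacian

end NeumannLS

/-! ### Integrals over layers above a graph, and traces -/

namespace NeumannLS

section LayerCutoff

/-- A smooth cutoff on the line: `0` up to `1`, and `1` from `2` on. -/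
noncomputable def layerCutoff (τ : ℝ) : ℝ := Real.smoothTransition (τ - 1)

lemma contDiff_layerCutoff : ContDiff ℝ 1 layerCutoff :=
  Real.smoothTransition.contDiff.comp (contDiff_id.sub contDiff_const)

lemma layerCutoff_of_le {τ : ℝ} (h : τ ≤ 1) : layerCutoff τ = 0 :=
  Real.smoothTransition.zero_of_nonpos (by linarith)

lemma layerCutoff_of_ge {τ : ℝ} (h : 2 ≤ τ) : layerCutoff τ = 1 :=
  Real.smoothTransition.one_of_one_le (by linarith)

lemma layerCutoff_nonneg (τ : ℝ) : 0 ≤ layerCutoff τ := Real.smoothTransition.nonneg _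

lemma layerCutoff_le_one (τ : ℝ) : layerCutoff τ ≤ 1 := Real.smoothTransition.le_one _

lemma abs_layerCutoff_le_one (τ : ℝ) : |layerCutoff τ| ≤ 1 := by
  rw [abs_of_nonneg (layerCutoff_nonneg τ)]
  exact layerCutoff_le_one τ

lemma deriv_layerCutoff_of_le {τ : ℝ} (h : τ ≤ 1) : deriv layerCutoff τ = 0 := by
  refine IsLocalMin.deriv_eq_zero (Filter.Eventually.of_forall fun s ↦ ?_)
  rw [layerCutoff_of_le h]
  exact layerCutoff_nonneg s

lemma deriv_layerCutoff_of_ge {τ : ℝ} (h : 2 ≤ τ) : deriv layerCutoff τ = 0 := by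
  refine IsLocalMax.deriv_eq_zero (Filter.Eventually.of_forall fun s ↦ ?_)
  rw [layerCutoff_of_ge h]
  exact layerCutoff_le_one s

lemma continuous_deriv_layerCutoff : Continuous (deriv layerCutoff) :=
  contDiff_layerCutoff.continuous_deriv le_rfl

lemma deriv_layerCutoff_of_notMem {τ : ℝ} (h : τ ∉ Icc (1 : ℝ) 2) : deriv layerCutoff τ = 0 := by
  by_cases h1 : τ ≤ 1
  · exact deriv_layerCutoff_of_le h1
  · exact deriv_layerCutoff_of_ge (not_lt.1 fun h2 ↦ h ⟨(not_le.1 h1).le, h2.le⟩)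

lemma integral_deriv_layerCutoff : ∫ τ, deriv layerCutoff τ = 1 := by
  have h1 : Function.support (deriv layerCutoff) ⊆ Ioc 1 2 := by
    intro τ hτ
    by_contra h
    refine hτ ?_
    by_cases h1 : τ ≤ 1
    · exact deriv_layerCutoff_of_le h1
    · exact deriv_layerCutoff_of_ge (not_lt.1 fun h2 ↦ h ⟨not_le.1 h1, h2.le⟩)
  rw [← intervalIntegral.integral_eq_integral_of_support_subset h1,
    intervalIntegral.integral_deriv_eq_sub
      (fun x _ ↦ contDiff_layerCutoff.differentiable one_ne_zero x)
      (continuous_deriv_layerCutoff.intervalIntegrable _ _),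
    layerCutoff_of_ge le_rfl, layerCutoff_of_le le_rfl, sub_zero]

end LayerCutoff

section Epigraph

variable {E : Type*} [NormedAddCommGroup E] [InnerProductSpace ℝ E] [FiniteDimensional ℝ E]
  [MeasurableSpace E] [BorelSpace E] {ν : E} {γ : (ℝ ∙ ν)ᗮ → ℝ}

/-- Integrals over thin layers above a graph, normalized by their thickness, converge to the
integral over the graph in the base coordinates. -/
lemma tendsto_integral_layer (hν : ‖ν‖ = 1) (hγ : Continuous γ) {q : E → ℝ} {S : Set E}
    (hq : ContinuousOn q {x | 0 ≤ height ν γ x}) (hS : IsCompact S) (h0 : ∀ x ∉ S, q x = 0) :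
    Filter.Tendsto
      (fun t : ℝ ↦ ∫ x, t⁻¹ * deriv layerCutoff (t⁻¹ * height ν γ x) * q x) (𝓝[>] 0)
      (𝓝 (∫ y, q (graphPoint ν γ y 0))) := by
  have hgc := continuous_graphPoint (ν := ν) hγ
  let Q : (ℝ ∙ ν)ᗮ × ℝ → ℝ := fun p ↦ q (graphPoint ν γ p.1 (max p.2 0))
  have hQ : Continuous Q := hq.comp_continuous
    (hgc.comp (by fun_prop : Continuous fun p : (ℝ ∙ ν)ᗮ × ℝ ↦ (p.1, max p.2 0)))
    fun p ↦ by simp [height_graphPoint hν]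
  set K : Set (ℝ ∙ ν)ᗮ := (ℝ ∙ ν)ᗮ.orthogonalProjectionOnto '' S
  have hK : IsCompact K := hS.image (ℝ ∙ ν)ᗮ.orthogonalProjectionOnto.continuous
  have hQ0 (y : (ℝ ∙ ν)ᗮ) (s : ℝ) (hy : y ∉ K) : Q (y, s) = 0 := by
    refine h0 _ fun h ↦ hy ⟨_, h, orthogonalProjection_graphPoint y _⟩
  -- `Q` vanishes over bases outside `K`, but not for very negative heights; it is bounded since
  -- `q` is continuous on the compact part of `S` above the graph
  obtain ⟨M, hM⟩ : ∃ M, ∀ p, ‖Q p‖ ≤ M := by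
    have hcl : IsClosed {x | 0 ≤ height ν γ x} := by
      refine isClosed_le continuous_const ?_
      unfold height
      fun_prop
    obtain ⟨M, hM⟩ := (hS.inter_right hcl).exists_bound_of_continuousOn
      (hq.mono inter_subset_right)
    refine ⟨max M 0, fun p ↦ ?_⟩
    by_cases h : graphPoint ν γ p.1 (max p.2 0) ∈ S
    · exact (hM _ ⟨h, by simp [height_graphPoint hν]⟩).trans (le_max_left _ _)
    · simp only [Q]
      rw [h0 _ h]
      simp
  obtain ⟨M', hM'⟩ : ∃ M', ∀ τ, ‖deriv layerCutoff τ‖ ≤ M' :=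
    (HasCompactSupport.intro isCompact_Icc fun τ hτ ↦
      deriv_layerCutoff_of_notMem hτ).exists_bound_of_continuous continuous_deriv_layerCutoff
  have hM0 : 0 ≤ M := (norm_nonneg _).trans (hM (0, 0))
  have hM0' : 0 ≤ M' := (norm_nonneg _).trans (hM' 0)
  have hlim : Filter.Tendsto
      (fun t : ℝ ↦ ∫ p : (ℝ ∙ ν)ᗮ × ℝ, deriv layerCutoff p.2 * Q (p.1, t * p.2)) (𝓝[>] 0)
      (𝓝 (∫ p : (ℝ ∙ ν)ᗮ × ℝ, deriv layerCutoff p.2 * Q (p.1, 0))) := by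
    refine tendsto_integral_filter_of_dominated_convergence
      ((K ×ˢ Icc (1 : ℝ) 2).indicator fun _ ↦ M' * M) ?_ ?_ ?_ ?_
    · refine Filter.Eventually.of_forall fun t ↦ Continuous.aestronglyMeasurable ?_
      exact (continuous_deriv_layerCutoff.comp continuous_snd).mul
        (hQ.comp (by fun_prop : Continuous fun p : (ℝ ∙ ν)ᗮ × ℝ ↦ (p.1, t * p.2)))
    · refine Filter.Eventually.of_forall fun t ↦ Filter.Eventually.of_forall fun p ↦ ?_
      by_cases hp : p ∈ K ×ˢ Icc (1 : ℝ) 2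
      · rw [indicator_of_mem hp, norm_mul]
        exact mul_le_mul (hM' _) (hM _) (norm_nonneg _) hM0'
      · rw [indicator_of_notMem hp]
        by_cases hp1 : p.1 ∈ K
        · rw [deriv_layerCutoff_of_notMem fun h ↦ hp ⟨hp1, h⟩]
          simp
        · rw [hQ0 _ _ hp1]
          simp
    · rw [integrable_indicator_iff (hK.prod isCompact_Icc).measurableSet]
      exact continuousOn_const.integrableOn_compact (hK.prod isCompact_Icc)
    · refine Filter.Eventually.of_forall fun p ↦ Filter.Tendsto.mul tendsto_const_nhds ?_
      have : Continuous fun t : ℝ ↦ Q (p.1, t * p.2) := hQ.comp (by fun_prop)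
      simpa using (this.tendsto 0).mono_left nhdsWithin_le_nhds
  have hval : ∫ p : (ℝ ∙ ν)ᗮ × ℝ, deriv layerCutoff p.2 * Q (p.1, 0) =
      ∫ y, q (graphPoint ν γ y 0) := by
    simp_rw [mul_comm (deriv layerCutoff _)]
    have h1 := integral_prod_mul (μ := (volume : Measure (ℝ ∙ ν)ᗮ)) (ν := (volume : Measure ℝ))
      (fun y ↦ Q (y, 0)) (deriv layerCutoff)
    rw [integral_deriv_layerCutoff, mul_one] at h1
    refine h1.trans ?_
    simp [Q]
  rw [hval] at hlim
  refine hlim.congr' ?_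
  filter_upwards [self_mem_nhdsWithin] with t (ht : 0 < t)
  have hcont1 : Continuous fun p : (ℝ ∙ ν)ᗮ × ℝ ↦ deriv layerCutoff p.2 * Q (p.1, t * p.2) :=
    (continuous_deriv_layerCutoff.comp continuous_snd).mul
      (hQ.comp (by fun_prop : Continuous fun p : (ℝ ∙ ν)ᗮ × ℝ ↦ (p.1, t * p.2)))
  have hcont2 : Continuous fun p : (ℝ ∙ ν)ᗮ × ℝ ↦
      t⁻¹ * deriv layerCutoff (t⁻¹ * p.2) * Q (p.1, p.2) :=
    (continuous_const.mul (continuous_deriv_layerCutoff.comp (by fun_prop))).mul hQ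
  have hcs1 : HasCompactSupport fun p : (ℝ ∙ ν)ᗮ × ℝ ↦
      deriv layerCutoff p.2 * Q (p.1, t * p.2) := by
    refine HasCompactSupport.intro (hK.prod (isCompact_Icc (a := (1 : ℝ)) (b := 2)))
      fun p hp ↦ ?_
    by_cases hp1 : p.1 ∈ K
    · rw [deriv_layerCutoff_of_notMem fun h ↦ hp ⟨hp1, h⟩, zero_mul]
    · rw [hQ0 _ _ hp1, mul_zero]
  have hcs2 : HasCompactSupport fun p : (ℝ ∙ ν)ᗮ × ℝ ↦
      t⁻¹ * deriv layerCutoff (t⁻¹ * p.2) * Q (p.1, p.2) := by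
    refine HasCompactSupport.intro (hK.prod (isCompact_Icc (a := t) (b := 2 * t)))
      fun p hp ↦ ?_
    by_cases hp1 : p.1 ∈ K
    · rw [deriv_layerCutoff_of_notMem fun h ↦ hp ⟨hp1, ?_⟩, mul_zero, zero_mul]
      rw [inv_mul_eq_div, mem_Icc, one_le_div ht, div_le_iff₀ ht] at h
      exact h
    · rw [hQ0 _ _ hp1, mul_zero]
  have hint1 := hcont1.integrable_of_hasCompactSupport
    (μ := (volume : Measure (ℝ ∙ ν)ᗮ).prod (volume : Measure ℝ)) hcs1
  have hint2 := hcont2.integrable_of_hasCompactSupport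
    (μ := (volume : Measure (ℝ ∙ ν)ᗮ).prod (volume : Measure ℝ)) hcs2
  have hinj : Function.Injective fun p : (ℝ ∙ ν)ᗮ × ℝ ↦ graphPoint ν γ p.1 p.2 := by
    intro p p' h
    refine Prod.ext ?_ ?_
    · simpa [orthogonalProjection_graphPoint] using
        congrArg (ℝ ∙ ν)ᗮ.orthogonalProjectionOnto h
    · simpa [height_graphPoint hν] using congrArg (height ν γ) h
  have hchange := (measurePreserving_graphPoint hν hγ).integral_comp
    (hgc.measurableEmbedding hinj)
    (fun x ↦ t⁻¹ * deriv layerCutoff (t⁻¹ * height ν γ x) * q x)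
  rw [← hchange]
  have hpt (p : (ℝ ∙ ν)ᗮ × ℝ) : t⁻¹ * deriv layerCutoff (t⁻¹ * height ν γ (graphPoint ν γ p.1 p.2))
      * q (graphPoint ν γ p.1 p.2) = t⁻¹ * deriv layerCutoff (t⁻¹ * p.2) * Q (p.1, p.2) := by
    rw [height_graphPoint hν]
    by_cases hs : 0 ≤ p.2
    · simp [Q, max_eq_left hs]
    · have : t⁻¹ * p.2 ≤ 1 := by
        have := mul_nonpos_of_nonneg_of_nonpos (inv_nonneg.2 ht.le) (not_le.1 hs).le
        linarith
      rw [deriv_layerCutoff_of_le this]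
      simp
  simp_rw [hpt]
  rw [Measure.volume_eq_prod, integral_prod _ hint1, integral_prod _ hint2]
  refine integral_congr_ae (Filter.Eventually.of_forall fun y ↦ ?_)
  have h3 := Measure.integral_comp_inv_mul_left
    (fun τ ↦ t⁻¹ * deriv layerCutoff τ * Q (y, t * τ)) t
  simp only [mul_inv_cancel_left₀ ht.ne', abs_of_pos ht, smul_eq_mul] at h3
  simp only
  rw [h3, ← integral_const_mul]
  congr 1
  ext τ
  field_simp

/-- A trace inequality above a graph: the fundamental theorem of calculus along `ν`. -/
lemma lintegral_graph_le (hν : ‖ν‖ = 1) (hγ : Continuous γ) {v : E → ℝ} {S : Set E}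
    (hv : ContinuousOn v {x | 0 ≤ height ν γ x})
    (hd : ∀ x, 0 < height ν γ x → DifferentiableAt ℝ v x)
    (hS : IsCompact S) (h0 : ∀ x ∉ S, v x = 0) :
    ∫⁻ y, ‖v (graphPoint ν γ y 0)‖ₑ ^ 2 ≤
      ∫⁻ x in {x | 0 < height ν γ x}, (‖v x‖ₑ ^ 2 + ‖fderiv ℝ v x‖ₑ ^ 2) := by
  have hgc := continuous_graphPoint (ν := ν) hγ
  have hhc : Continuous (height ν γ) := by
    unfold height
    fun_prop
  set H : Set E := {x | 0 < height ν γ x}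
  have hH : IsOpen H := isOpen_lt continuous_const hhc
  set f : E → ℝ≥0∞ := fun x ↦ ‖v x‖ₑ ^ 2 + ‖fderiv ℝ v x‖ₑ ^ 2
  have hline (y : (ℝ ∙ ν)ᗮ) : ‖v (graphPoint ν γ y 0)‖ₑ ^ 2 ≤
      ∫⁻ s in Ioi (0 : ℝ), f (graphPoint ν γ y s) := by
    set p : ℝ → ℝ := fun s ↦ v (graphPoint ν γ y s) ^ 2
    have hgl : Continuous fun s : ℝ ↦ graphPoint ν γ y s :=
      hgc.comp (by fun_prop : Continuous fun s : ℝ ↦ (y, s))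
    have hder (s : ℝ) (hs : s ∈ Ioi (0 : ℝ)) : HasDerivAt p
        (2 * v (graphPoint ν γ y s) * fderiv ℝ v (graphPoint ν γ y s) ν) s := by
      have h1 : HasDerivAt (fun s : ℝ ↦ graphPoint ν γ y s) ν s := by
        unfold graphPoint
        simpa using (((hasDerivAt_id s).add_const (γ y)).smul_const ν).const_add (y : E)
      have h2 := (hd (graphPoint ν γ y s)
        (by rw [height_graphPoint hν]; exact hs)).hasFDerivAt.comp_hasDerivAt s h1
      have h3 : HasDerivAt p _ s := h2.pow 2
      convert h3 using 1
      simp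
    have hpc : ContinuousWithinAt p (Ici 0) 0 := by
      have h1 : ContinuousWithinAt (fun s : ℝ ↦ v (graphPoint ν γ y s)) (Ici 0) 0 := by
        refine (hv (graphPoint ν γ y 0) (by simp [height_graphPoint hν])).comp
          hgl.continuousWithinAt fun s hs ↦ ?_
        simpa [height_graphPoint hν] using hs
      exact h1.pow 2
    have hpt : Filter.Tendsto p Filter.atTop (𝓝 0) := by
      obtain ⟨R, hR⟩ := (hS.image hhc).bddAbove
      refine tendsto_const_nhds.congr' ?_
      filter_upwards [Filter.eventually_gt_atTop R] with s hs
      have : graphPoint ν γ y s ∉ S := fun h ↦ by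
        have := hR ⟨_, h, height_graphPoint hν y s⟩
        linarith
      simp [p, h0 _ this]
    have hbound : ∫⁻ s in Ioi (0 : ℝ), ‖deriv p s‖ₑ ≤
        ∫⁻ s in Ioi (0 : ℝ), f (graphPoint ν γ y s) := by
      refine setLIntegral_mono' measurableSet_Ioi fun s hs ↦ ?_
      rw [(hder s hs).deriv]
      set a := v (graphPoint ν γ y s)
      set L := fderiv ℝ v (graphPoint ν γ y s)
      have h1 : ‖2 * a * L ν‖ ≤ ‖a‖ ^ 2 + ‖L‖ ^ 2 := by
        have h2 : ‖L ν‖ ≤ ‖L‖ := by simpa [hν] using L.le_opNorm ν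
        rw [norm_mul, norm_mul, Real.norm_ofNat]
        nlinarith [sq_nonneg (‖a‖ - ‖L‖), norm_nonneg a]
      simp only [f, ← ofReal_norm]
      rw [← ENNReal.ofReal_pow (norm_nonneg _), ← ENNReal.ofReal_pow (norm_nonneg _),
        ← ENNReal.ofReal_add (by positivity) (by positivity)]
      exact ENNReal.ofReal_le_ofReal h1
    refine le_trans ?_ hbound
    by_cases hint : IntegrableOn (deriv p) (Ioi 0)
    · have h1 := integral_Ioi_of_hasDerivAt_of_tendsto hpc
        (fun s hs ↦ (hder s hs).differentiableAt.hasDerivAt) hint hpt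
      have h2 : ‖v (graphPoint ν γ y 0)‖ₑ ^ 2 = ‖∫ s in Ioi (0 : ℝ), deriv p s‖ₑ := by
        rw [h1, zero_sub, enorm_neg, enorm_pow]
      rw [h2]
      exact enorm_integral_le_lintegral_enorm _
    -- if the derivative is not integrable, the right-hand side is infinite
    · have h1 : ∫⁻ s in Ioi (0 : ℝ), ‖deriv p s‖ₑ = ⊤ := by
        by_contra h
        exact hint ⟨(measurable_deriv p).aestronglyMeasurable, lt_top_iff_ne_top.2 h⟩
      rw [h1]
      exact le_top
  have hfm : AEMeasurable (H.indicator f) volume := by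
    rw [aemeasurable_indicator_iff hH.measurableSet]
    have h1 : AEMeasurable v (volume.restrict H) :=
      (hv.mono fun x (hx : 0 < height ν γ x) ↦ hx.le).aemeasurable hH.measurableSet
    exact (h1.enorm.pow_const 2).add ((measurable_fderiv ℝ v).enorm.pow_const 2).aemeasurable
  have hmp := measurePreserving_graphPoint (ν := ν) hν hγ
  calc ∫⁻ y, ‖v (graphPoint ν γ y 0)‖ₑ ^ 2
      ≤ ∫⁻ y, ∫⁻ s, H.indicator f (graphPoint ν γ y s) := by
        refine lintegral_mono fun y ↦ (hline y).trans (le_of_eq ?_)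
        rw [← lintegral_indicator measurableSet_Ioi]
        refine lintegral_congr fun s ↦ ?_
        by_cases hs : 0 < s
        · rw [indicator_of_mem (by exact hs), indicator_of_mem]
          simpa [H, height_graphPoint hν] using hs
        · rw [indicator_of_notMem (by exact hs), indicator_of_notMem]
          simpa [H, height_graphPoint hν] using hs
    _ = ∫⁻ p, H.indicator f (graphPoint ν γ p.1 p.2) ∂(volume.prod volume) :=
        (lintegral_prod _ (hfm.comp_quasiMeasurePreserving hmp.quasiMeasurePreserving)).symm
    _ = ∫⁻ x, H.indicator f x := by
        rw [← hmp.map_eq] at hfm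
        conv_rhs => rw [← hmp.map_eq]
        rw [lintegral_map' hfm hmp.measurable.aemeasurable]
    _ = _ := lintegral_indicator hH.measurableSet f

end Epigraph

end NeumannLS

/-! ### Green's formula in a graph chart -/

namespace NeumannLS

variable {d : ℕ} {Ω U : Set (Space d)} {ν : Space d} {γ : (ℝ ∙ ν)ᗮ → ℝ}

lemma fderivWithin_closure_eq (hΩ : IsOpen Ω) {x : Space d} (hx : x ∈ Ω) (w : Space d → ℝ) :
    fderivWithin ℝ w (closure Ω) x = fderiv ℝ w x :=
  fderivWithin_of_mem_nhds (Filter.mem_of_superset (hΩ.mem_nhds hx) subset_closure)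

lemma enorm_gradient (w : Space d → ℝ) (x : Space d) : ‖gradient w x‖ₑ = ‖fderiv ℝ w x‖ₑ := by
  simp [gradient, ← ofReal_norm]

lemma continuous_gradient_height (hγ : ContDiff ℝ 1 γ) : Continuous (gradient (height ν γ)) :=
  (toDual ℝ (Space d)).symm.continuous.comp ((contDiff_height hγ).continuous_fderiv one_ne_zero)

/-- A function of class `C¹` on the closure of a bounded open set is bounded together with its
derivative. -/
lemma exists_bound_of_contDiffOn_closure (hΩ : IsOpen Ω) (hb : Bornology.IsBounded Ω)
    (huniq : UniqueDiffOn ℝ (closure Ω)) {w : Space d → ℝ} (hw : ContDiffOn ℝ 1 w (closure Ω)) :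
    ∃ M, ∀ x ∈ Ω, ‖w x‖ ≤ M ∧ ‖fderiv ℝ w x‖ ≤ M := by
  obtain ⟨M, hM⟩ := hb.isCompact_closure.exists_bound_of_continuousOn hw.continuousOn
  obtain ⟨M', hM'⟩ := hb.isCompact_closure.exists_bound_of_continuousOn
    (hw.continuousOn_fderivWithin huniq le_rfl)
  refine ⟨max M M', fun x hx ↦ ⟨(hM x (subset_closure hx)).trans (le_max_left _ _), ?_⟩⟩
  rw [← fderivWithin_closure_eq hΩ hx]
  exact (hM' x (subset_closure hx)).trans (le_max_right _ _)

lemma integrableOn_of_continuousOn_of_bound (hΩ : IsOpen Ω) (hb : Bornology.IsBounded Ω)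
    {F : Type*} [NormedAddCommGroup F] {f : Space d → F} (hf : ContinuousOn f Ω)
    {M : ℝ} (hM : ∀ x ∈ Ω, ‖f x‖ ≤ M) : IntegrableOn f Ω :=
  IntegrableOn.of_bound hb.measure_lt_top (hf.aestronglyMeasurable hΩ.measurableSet) M
    ((ae_restrict_iff' hΩ.measurableSet).2 (Filter.Eventually.of_forall hM))

lemma continuousOn_gradient (hΩ : IsOpen Ω) {w : Space d → ℝ} (hw : ContDiffOn ℝ 1 w Ω) :
    ContinuousOn (gradient w) Ω :=
  (toDual ℝ (Space d)).symm.continuous.comp_continuousOn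
    (hw.continuousOn_fderiv_of_isOpen hΩ le_rfl)

lemma norm_gradient (w : Space d → ℝ) (x : Space d) : ‖gradient w x‖ = ‖fderiv ℝ w x‖ := by
  simp [gradient]

lemma integrableOn_gradient (hΩ : IsOpen Ω) (hb : Bornology.IsBounded Ω)
    (huniq : UniqueDiffOn ℝ (closure Ω)) {w : Space d → ℝ} (hw : ContDiffOn ℝ 1 w (closure Ω)) :
    IntegrableOn (gradient w) Ω := by
  obtain ⟨M, hM⟩ := exists_bound_of_contDiffOn_closure hΩ hb huniq hw
  exact integrableOn_of_continuousOn_of_bound hΩ hb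
    (continuousOn_gradient hΩ (hw.mono subset_closure))
    fun x hx ↦ (norm_gradient w x).le.trans (hM x hx).2

lemma integrableOn_cutoff_weak_integrand (hΩ : IsOpen Ω)
    (hb : Bornology.IsBounded Ω) (huniq : UniqueDiffOn ℝ (closure Ω)) {χ w h : Space d → ℝ}
    (hχ : ContDiff ℝ 1 χ) (hχc : HasCompactSupport χ)
    (hw : ContDiffOn ℝ 1 w (closure Ω)) (hh : IntegrableOn h Ω) :
    IntegrableOn
      (fun x ↦ fderiv ℝ (fun x ↦ χ x * w x) x (gradient w x) - h x * (χ x * w x)) Ω := by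
  have hwΩ : ContDiffOn ℝ 1 w Ω := hw.mono subset_closure
  set v : Space d → ℝ := fun x ↦ χ x * w x
  have hvΩ : ContDiffOn ℝ 1 v Ω := hχ.contDiffOn.mul hwΩ
  obtain ⟨M, hM⟩ := exists_bound_of_contDiffOn_closure hΩ hb huniq hw
  obtain ⟨A, hA⟩ := hχc.exists_bound_of_continuous hχ.continuous
  obtain ⟨A', hA'⟩ := (hχc.fderiv ℝ).exists_bound_of_continuous
    (hχ.continuous_fderiv one_ne_zero)
  have hvfd (x) (hx : x ∈ Ω) : ‖fderiv ℝ v x‖ ≤ A * M + M * A' := by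
    have hwd := (hwΩ.contDiffAt (hΩ.mem_nhds hx)).differentiableAt one_ne_zero
    have h1 : fderiv ℝ v x = _ := fderiv_fun_mul (hχ.differentiable one_ne_zero x) hwd
    rw [h1]
    refine (norm_add_le _ _).trans ?_
    rw [norm_smul, norm_smul]
    have hM0 := (norm_nonneg _).trans (hM x hx).1
    have hA0 := (norm_nonneg _).trans (hA x)
    exact add_le_add (mul_le_mul (hA x) (hM x hx).2 (norm_nonneg _) hA0)
      (mul_le_mul (hM x hx).1 (hA' x) (norm_nonneg _) hM0)
  have hgrc := continuousOn_gradient hΩ hwΩ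
  refine IntegrableOn.sub ?_ ?_
  · refine integrableOn_of_continuousOn_of_bound hΩ hb
      (M := (A * M + M * A') * M)
      ((hvΩ.continuousOn_fderiv_of_isOpen hΩ le_rfl).clm_apply hgrc) fun x hx ↦ ?_
    refine ((fderiv ℝ v x).le_opNorm _).trans
      (mul_le_mul (hvfd x hx) ?_ (norm_nonneg _) ((norm_nonneg _).trans (hvfd x hx)))
    rw [norm_gradient]
    exact (hM x hx).2
  · refine Integrable.mul_bdd (c := A * M) hh
      (hvΩ.continuousOn.aestronglyMeasurable hΩ.measurableSet) ?_
    refine (ae_restrict_iff' hΩ.measurableSet).2 (Filter.Eventually.of_forall fun x hx ↦ ?_)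
    rw [norm_mul]
    exact mul_le_mul (hA x) (hM x hx).1 (norm_nonneg _) ((norm_nonneg _).trans (hA x))

namespace IsGraphChart

/-- The conormal flux `χ w ⟨∇w, ∇(height)⟩`, cut off to the chart and continuous up to the
boundary. -/
noncomputable def flux (Ω : Set (Space d)) (γ : (ℝ ∙ ν)ᗮ → ℝ) (χ w : Space d → ℝ)
    (x : Space d) : ℝ :=
  χ x * w x * fderivWithin ℝ w (closure Ω) x (gradient (height ν γ) x)

lemma continuousOn_cutoff_mul (hc : IsGraphChart Ω U ν γ) {χ f : Space d → ℝ} (hχ : Continuous χ)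
    (hχU : tsupport χ ⊆ U) (hf : ContinuousOn f (closure Ω)) :
    ContinuousOn (fun x ↦ χ x * f x) {x | 0 ≤ height ν γ x} := by
  intro x hx
  by_cases hxs : x ∈ tsupport χ
  · have hxU := hχU hxs
    have h1 : ContinuousWithinAt (fun x ↦ χ x * f x) (closure Ω) x :=
      hχ.continuousWithinAt.mul (hf x ((hc.mem_closure_iff hxU).2 hx))
    refine h1.mono_of_mem_nhdsWithin ?_
    filter_upwards [self_mem_nhdsWithin, nhdsWithin_le_nhds (hc.isOpen.mem_nhds hxU)] with y hy hyU
    exact (hc.mem_closure_iff hyU).2 hy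
  · have : (fun x ↦ χ x * f x) =ᶠ[𝓝 x] fun _ ↦ 0 := by
      filter_upwards [(isClosed_tsupport χ).isOpen_compl.mem_nhds hxs] with y hy
      rw [image_eq_zero_of_notMem_tsupport hy, zero_mul]
    exact (continuousAt_const.congr this.symm).continuousWithinAt

/-- Green's formula in a graph chart, for a function `w` whose gradient `∇w` has the weak
divergence `-h`. The test functions `χ w` are cut off near the boundary and the width of the layer
tends to zero. -/
lemma integral_cutoff_eq_neg_flux (hc : IsGraphChart Ω U ν γ) (hΩ : IsOpen Ω)
    (hb : Bornology.IsBounded Ω) (huniq : UniqueDiffOn ℝ (closure Ω)) {χ w h : Space d → ℝ}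
    (hχ : ContDiff ℝ 1 χ) (hχc : HasCompactSupport χ) (hχU : tsupport χ ⊆ U)
    (hw : ContDiffOn ℝ 1 w (closure Ω)) (hh : IntegrableOn h Ω)
    (H : ∀ φ : Space d → ℝ, ContDiff ℝ 1 φ → HasCompactSupport φ → tsupport φ ⊆ Ω →
      ∫ x in Ω, (fderiv ℝ φ x (gradient w x) - h x * φ x) = 0) :
    ∫ x in Ω, (fderiv ℝ (fun x ↦ χ x * w x) x (gradient w x) - h x * (χ x * w x)) =
      -∫ y, flux Ω γ χ w (graphPoint ν γ y 0) := by
  set g := height ν γ with hg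
  have hgC : ContDiff ℝ 1 g := contDiff_height hc.contDiff
  have hgc : Continuous g := hgC.continuous
  have hgd : Differentiable ℝ g := hgC.differentiable one_ne_zero
  have hwΩ : ContDiffOn ℝ 1 w Ω := hw.mono subset_closure
  set v : Space d → ℝ := fun x ↦ χ x * w x with hv
  have hvΩ : ContDiffOn ℝ 1 v Ω := hχ.contDiffOn.mul hwΩ
  have hvd (x) (hx : x ∈ Ω) : DifferentiableAt ℝ v x :=
    (hvΩ.contDiffAt (hΩ.mem_nhds hx)).differentiableAt one_ne_zero
  have hv0 (x) (hx : x ∉ tsupport χ) : v x = 0 := by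
    rw [hv]
    simp [image_eq_zero_of_notMem_tsupport hx]
  have hvd0 (x) (hx : x ∉ tsupport χ) : fderiv ℝ v x = 0 :=
    fderiv_eq_zero_of_notMem_tsupport fun h ↦ hx (tsupport_mul_subset_left h)
  set η : ℝ → Space d → ℝ := fun t x ↦ layerCutoff (t⁻¹ * g x) with hη
  have hηC (t : ℝ) : ContDiff ℝ 1 (η t) := contDiff_layerCutoff.comp (contDiff_const.mul hgC)
  have hηd (t : ℝ) (x z : Space d) : fderiv ℝ (η t) x z =
      t⁻¹ * deriv layerCutoff (t⁻¹ * g x) * fderiv ℝ g x z := by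
    have h1 := (contDiff_layerCutoff.differentiable one_ne_zero (t⁻¹ * g x)).hasDerivAt
    have h2 : HasFDerivAt (fun x ↦ t⁻¹ * g x) (t⁻¹ • fderiv ℝ g x) x :=
      (hgd x).hasFDerivAt.const_mul _
    have h3 := h1.comp_hasFDerivAt x h2
    have h4 : fderiv ℝ (η t) x = _ := h3.fderiv
    rw [h4]
    simp
    ring
  -- the cut-off test functions are supported inside the domain
  have hK (t : ℝ) (ht : 0 < t) : tsupport χ ∩ {x | t ≤ g x} ⊆ Ω := fun x hx ↦
    (hc.mem_iff x (hχU hx.1)).2 (ht.trans_le hx.2)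
  have hKc (t : ℝ) : IsClosed (tsupport χ ∩ {x | t ≤ g x}) :=
    (isClosed_tsupport χ).inter (isClosed_le continuous_const hgc)
  have hψ0 (t : ℝ) (ht : 0 < t) (x) (hx : x ∉ tsupport χ ∩ {x | t ≤ g x}) : v x * η t x = 0 := by
    by_cases h1 : x ∈ tsupport χ
    · have h2 : g x < t := not_le.1 fun h ↦ hx ⟨h1, h⟩
      have h3 : t⁻¹ * g x ≤ 1 := by
        rw [inv_mul_eq_div, div_le_one ht]
        exact h2.le
      rw [hη]
      simp [layerCutoff_of_le h3]
    · rw [hv0 x h1, zero_mul]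
  have hψC (t : ℝ) (ht : 0 < t) : ContDiff ℝ 1 fun x ↦ v x * η t x :=
    contDiff_of_eq_zero_off hΩ (hKc t) (hK t ht) (hvΩ.mul (hηC t).contDiffOn) (hψ0 t ht)
  have hψs (t : ℝ) (ht : 0 < t) : tsupport (fun x ↦ v x * η t x) ⊆
      tsupport χ ∩ {x | t ≤ g x} :=
    closure_minimal (fun x hx ↦ by_contra fun h ↦ hx (hψ0 t ht x h)) (hKc t)
  have hψc (t : ℝ) (ht : 0 < t) : HasCompactSupport fun x ↦ v x * η t x :=
    (hχc.isCompact.inter_right (isClosed_le continuous_const hgc)).of_isClosed_subset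
      (isClosed_tsupport _) (hψs t ht)
  have hgri := integrableOn_gradient hΩ hb huniq hw
  have hint0 := integrableOn_cutoff_weak_integrand hΩ hb huniq hχ hχc hw hh
  -- the interior part of the tested equation converges by dominated convergence
  have hlim1 : Filter.Tendsto
      (fun t : ℝ ↦ ∫ x in Ω, η t x * (fderiv ℝ v x (gradient w x) - h x * v x)) (𝓝[>] 0)
      (𝓝 (∫ x in Ω, (fderiv ℝ v x (gradient w x) - h x * v x))) := by
    refine tendsto_integral_filter_of_dominated_convergence
      (fun x ↦ ‖fderiv ℝ v x (gradient w x) - h x * v x‖) ?_ ?_ hint0.norm ?_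
    · exact Filter.Eventually.of_forall fun t ↦
        (hηC t).continuous.aestronglyMeasurable.mul hint0.aestronglyMeasurable
    · refine Filter.Eventually.of_forall fun t ↦ Filter.Eventually.of_forall fun x ↦ ?_
      rw [norm_mul]
      exact mul_le_of_le_one_left (norm_nonneg _) (abs_layerCutoff_le_one _)
    · refine (ae_restrict_iff' hΩ.measurableSet).2 (Filter.Eventually.of_forall fun x hx ↦ ?_)
      by_cases hxs : x ∈ tsupport χ
      · have hgx : 0 < g x := (hc.mem_iff x (hχU hxs)).1 hx
        refine tendsto_const_nhds.congr' ?_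
        have h2 : ∀ᶠ t : ℝ in 𝓝[>] 0, t < g x / 2 :=
          nhdsWithin_le_nhds (eventually_lt_nhds (half_pos hgx))
        filter_upwards [h2, self_mem_nhdsWithin] with t ht (ht0 : 0 < t)
        have h3 : 2 ≤ t⁻¹ * g x := by
          rw [inv_mul_eq_div, le_div_iff₀ ht0]
          linarith
        rw [hη]
        simp [layerCutoff_of_ge h3]
      · rw [hv0 x hxs, hvd0 x hxs]
        simp
  -- the layer part converges to the boundary flux
  have hlim2 : Filter.Tendsto
      (fun t : ℝ ↦ ∫ x in Ω, t⁻¹ * deriv layerCutoff (t⁻¹ * g x) * flux Ω γ χ w x) (𝓝[>] 0)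
      (𝓝 (∫ y, flux Ω γ χ w (graphPoint ν γ y 0))) := by
    have hfl : flux Ω γ χ w = fun x ↦ χ x *
        (w x * fderivWithin ℝ w (closure Ω) x (gradient (height ν γ) x)) := by
      ext x
      rw [flux, mul_assoc]
    have hq : ContinuousOn (flux Ω γ χ w) {x | 0 ≤ height ν γ x} := by
      rw [hfl]
      refine hc.continuousOn_cutoff_mul hχ.continuous hχU (hw.continuousOn.mul ?_)
      exact (hw.continuousOn_fderivWithin huniq le_rfl).clm_apply
        (continuous_gradient_height hc.contDiff).continuousOn
    have hfl0 (x) (hx : x ∉ tsupport χ) : flux Ω γ χ w x = 0 := by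
      rw [flux, image_eq_zero_of_notMem_tsupport hx, zero_mul, zero_mul]
    refine (tendsto_integral_layer hc.norm_eq_one hc.contDiff.continuous hq hχc.isCompact
      hfl0).congr' ?_
    filter_upwards [self_mem_nhdsWithin] with t (ht : 0 < t)
    refine (setIntegral_eq_integral_of_forall_compl_eq_zero fun x hx ↦ ?_).symm
    by_cases hxs : x ∈ tsupport χ
    · have hgx : g x ≤ 0 := not_lt.1 fun h ↦ hx ((hc.mem_iff x (hχU hxs)).2 h)
      have h3 : t⁻¹ * g x ≤ 1 := by
        have := mul_nonpos_of_nonneg_of_nonpos (inv_nonneg.2 ht.le) hgx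
        linarith
      rw [deriv_layerCutoff_of_le h3]
      simp
    · rw [hfl0 x hxs, mul_zero]
  have hsum : ∀ᶠ t : ℝ in 𝓝[>] 0,
      (∫ x in Ω, η t x * (fderiv ℝ v x (gradient w x) - h x * v x)) =
        -∫ x in Ω, t⁻¹ * deriv layerCutoff (t⁻¹ * g x) * flux Ω γ χ w x := by
    filter_upwards [self_mem_nhdsWithin] with t (ht : 0 < t)
    have h1 := H _ (hψC t ht) (hψc t ht) ((hψs t ht).trans (hK t ht))
    have hpt : ∀ x ∈ Ω, fderiv ℝ (fun x ↦ v x * η t x) x (gradient w x) -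
        h x * (v x * η t x) = η t x * (fderiv ℝ v x (gradient w x) - h x * v x) +
          t⁻¹ * deriv layerCutoff (t⁻¹ * g x) * flux Ω γ χ w x := by
      intro x hx
      have e1 : fderiv ℝ g x (gradient w x) = fderiv ℝ w x (gradient g x) := by
        rw [← inner_gradient_left, ← inner_gradient_left, real_inner_comm]
      rw [fderiv_fun_mul (hvd x hx) ((hηC t).differentiable one_ne_zero x), flux,
        fderivWithin_closure_eq hΩ hx]
      simp only [add_apply, smul_apply, smul_eq_mul, hηd, e1, hv]
      ring
    have hi1 : IntegrableOn (fun x ↦ η t x * (fderiv ℝ v x (gradient w x) - h x * v x)) Ω :=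
      hint0.bdd_mul (c := 1) (hηC t).continuous.aestronglyMeasurable
        (Filter.Eventually.of_forall fun x ↦ abs_layerCutoff_le_one _)
    have hi2 : IntegrableOn
        (fun x ↦ t⁻¹ * deriv layerCutoff (t⁻¹ * g x) * flux Ω γ χ w x) Ω := by
      refine IntegrableOn.congr_fun (((integrable_fderiv_apply (hψC t ht) (hψc t ht) hgri).sub
        (integrable_mul_of_hasCompactSupport (hψC t ht).continuous (hψc t ht) hh)).sub hi1)
        (fun x hx ↦ ?_) hΩ.measurableSet
      have := hpt x hx
      simp only [Pi.sub_apply]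
      linarith
    rw [setIntegral_congr_fun hΩ.measurableSet hpt, integral_add hi1 hi2] at h1
    linarith
  refine tendsto_nhds_unique (hlim1.congr' hsum) hlim2.neg

end IsGraphChart

end NeumannLS

/-! ### Boundary terms in a graph chart -/

namespace NeumannLS

variable {d : ℕ} {Ω U : Set (Space d)} {ν : Space d} {γ : (ℝ ∙ ν)ᗮ → ℝ}

lemma h1Norm_sq (Ω : Set (Space d)) (w : Space d → ℝ) :
    h1Norm Ω w ^ 2 = ∫⁻ x in Ω, (‖w x‖ₑ ^ 2 + ‖gradient w x‖ₑ ^ 2) := by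
  rw [h1Norm, ← ENNReal.rpow_natCast, ← ENNReal.rpow_mul]
  norm_num

lemma sq_rpow_half (a : ℝ≥0∞) : (a ^ 2) ^ (1 / 2 : ℝ) = a := by
  rw [← ENNReal.rpow_natCast, ← ENNReal.rpow_mul]
  norm_num

/-- The Cauchy-Schwarz inequality for nonnegative functions. -/
lemma lintegral_mul_le_sqrt {α : Type*} [MeasurableSpace α] {μ : Measure α} {a b : α → ℝ≥0∞}
    (ha : AEMeasurable a μ) (hb : AEMeasurable b μ) :
    ∫⁻ x, a x * b x ∂μ ≤
      (∫⁻ x, a x ^ 2 ∂μ) ^ (1 / 2 : ℝ) * (∫⁻ x, b x ^ 2 ∂μ) ^ (1 / 2 : ℝ) := by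
  have h := ENNReal.lintegral_mul_le_Lp_mul_Lq μ (p := 2) (q := 2) Real.HolderConjugate.two_two ha hb
  simpa using h

namespace IsGraphChart

/-- The trace inequality in a graph chart. -/
lemma exists_trace_bound (hc : IsGraphChart Ω U ν γ) (hΩ : IsOpen Ω) {χ : Space d → ℝ}
    (hχ : ContDiff ℝ 1 χ) (hχc : HasCompactSupport χ) (hχU : tsupport χ ⊆ U) :
    ∃ C : NNReal, ∀ w : Space d → ℝ, ContDiffOn ℝ 1 w (closure Ω) →
      ∫⁻ y, ‖χ (graphPoint ν γ y 0) * w (graphPoint ν γ y 0)‖ₑ ^ 2 ≤ C * h1Norm Ω w ^ 2 := by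
  obtain ⟨A, hA⟩ := hχc.exists_bound_of_continuous hχ.continuous
  obtain ⟨A', hA'⟩ := (hχc.fderiv ℝ).exists_bound_of_continuous
    (hχ.continuous_fderiv one_ne_zero)
  refine ⟨(3 * A ^ 2 + 2 * A' ^ 2).toNNReal, fun w hw ↦ ?_⟩
  have hwΩ : ContDiffOn ℝ 1 w Ω := hw.mono subset_closure
  set v : Space d → ℝ := fun x ↦ χ x * w x with hv
  have hv0 (x) (hx : x ∉ tsupport χ) : v x = 0 := by
    rw [hv]
    simp [image_eq_zero_of_notMem_tsupport hx]
  have hvd0 (x) (hx : x ∉ tsupport χ) : fderiv ℝ v x = 0 :=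
    fderiv_eq_zero_of_notMem_tsupport fun h ↦ hx (tsupport_mul_subset_left h)
  have hwd (x) (hx : x ∈ Ω) : DifferentiableAt ℝ w x :=
    (hwΩ.contDiffAt (hΩ.mem_nhds hx)).differentiableAt one_ne_zero
  have h1 := lintegral_graph_le hc.norm_eq_one hc.contDiff.continuous
    (hc.continuousOn_cutoff_mul hχ.continuous hχU hw.continuousOn) (fun x hx ↦ ?_) hχc.isCompact
    hv0
  · refine h1.trans ?_
    have hH : IsOpen {x | 0 < height ν γ x} := isOpen_lt continuous_const hc.continuous_height
    rw [h1Norm_sq, ← lintegral_const_mul' _ _ ENNReal.coe_ne_top,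
      ← lintegral_indicator hH.measurableSet, ← lintegral_indicator hΩ.measurableSet]
    refine lintegral_mono fun x ↦ ?_
    by_cases hx : x ∈ tsupport χ
    · have hiff := hc.mem_iff x (hχU hx)
      by_cases hxΩ : x ∈ Ω
      · rw [indicator_of_mem (by exact hiff.1 hxΩ), indicator_of_mem hxΩ, enorm_gradient]
        have e1 : fderiv ℝ v x = _ := fderiv_fun_mul (hχ.differentiable one_ne_zero x) (hwd x hxΩ)
        have b1 : ‖fderiv ℝ v x‖ ≤ A * ‖fderiv ℝ w x‖ + A' * ‖w x‖ := by
          rw [e1]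
          refine (norm_add_le _ _).trans ?_
          rw [norm_smul, norm_smul, mul_comm ‖w x‖]
          gcongr
          · exact hA x
          · exact hA' x
        have b2 : ‖v x‖ ≤ A * ‖w x‖ := by
          rw [hv, norm_mul]
          gcongr
          exact hA x
        have b3 : ‖v x‖ ^ 2 + ‖fderiv ℝ v x‖ ^ 2 ≤
            (3 * A ^ 2 + 2 * A' ^ 2) * (‖w x‖ ^ 2 + ‖fderiv ℝ w x‖ ^ 2) := by
          have c1 := pow_le_pow_left₀ (norm_nonneg _) b1 2
          have c2 := pow_le_pow_left₀ (norm_nonneg _) b2 2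
          have c3 := sq_nonneg (A * ‖fderiv ℝ w x‖ - A' * ‖w x‖)
          have c4 := sq_nonneg (A * ‖fderiv ℝ w x‖)
          have c5 := sq_nonneg (A' * ‖fderiv ℝ w x‖)
          have c6 := sq_nonneg (A * ‖w x‖)
          nlinarith
        change ‖v x‖ₑ ^ 2 + ‖fderiv ℝ v x‖ₑ ^ 2 ≤ ENNReal.ofReal _ * _
        simp only [← ofReal_norm]
        simp only [← ENNReal.ofReal_pow (norm_nonneg _)]
        rw [← ENNReal.ofReal_add (by positivity) (by positivity),
          ← ENNReal.ofReal_add (by positivity) (by positivity),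
          ← ENNReal.ofReal_mul (by positivity)]
        exact ENNReal.ofReal_le_ofReal b3
      · rw [indicator_of_notMem (by exact fun h ↦ hxΩ (hiff.2 h))]
        exact zero_le
    · refine (indicator_apply_le' (a := x) (y := (0 : ℝ≥0∞)) (fun _ ↦ ?_)
        fun _ ↦ le_rfl).trans zero_le
      change ‖v x‖ₑ ^ 2 + ‖fderiv ℝ v x‖ₑ ^ 2 ≤ 0
      simp [← ofReal_norm, hv0 x hx, hvd0 x hx]
  · by_cases hxs : x ∈ tsupport χ
    · exact (hχ.differentiable one_ne_zero x).mul (hwd x ((hc.mem_iff x (hχU hxs)).2 hx))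
    · have : (fun x ↦ χ x * w x) =ᶠ[𝓝 x] fun _ ↦ 0 := by
        filter_upwards [(isClosed_tsupport χ).isOpen_compl.mem_nhds hxs] with y hy
        exact hv0 y hy
      exact this.differentiableAt_iff.2 (differentiableAt_const _)

lemma fderivWithin_gradient_height (hc : IsGraphChart Ω U ν γ) (w : Space d → ℝ) {x : Space d}
    (hx : x ∈ U) (h0 : height ν γ x = 0) :
    fderivWithin ℝ w (closure Ω) x (gradient (height ν γ) x) =
      -(‖gradient (height ν γ) x‖ * normalDeriv Ω w x) := by
  have hne := norm_ne_zero_iff.2 (gradient_height_ne_zero hc.norm_eq_one hc.contDiff x)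
  rw [normalDeriv, hc.outwardNormal_eq hx h0, map_neg, map_smul, smul_eq_mul]
  field_simp

/-- The boundary term of Green's formula in a graph chart is controlled by the normal derivative in
`L²` of the boundary, and by the `H¹` norm through the trace inequality. -/
lemma exists_flux_bound (hc : IsGraphChart Ω U ν γ) (hΩ : IsOpen Ω)
    (huniq : UniqueDiffOn ℝ (closure Ω)) {χ : Space d → ℝ}
    (hχ : ContDiff ℝ 1 χ) (hχc : HasCompactSupport χ) (hχU : tsupport χ ⊆ U) :
    ∃ C : NNReal, ∀ w : Space d → ℝ, ContDiffOn ℝ 1 w (closure Ω) →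
      ‖∫ y, flux Ω γ χ w (graphPoint ν γ y 0)‖ₑ ≤
        C * (h1Norm Ω w * (∫⁻ x, ‖normalDeriv Ω w x‖ₑ ^ 2 ∂surfaceMeasure Ω) ^ (1 / 2 : ℝ)) := by
  obtain ⟨C, hC⟩ := hc.exists_trace_bound hΩ hχ hχc hχU
  obtain ⟨J, hJ⟩ := hχc.isCompact.exists_bound_of_continuousOn
    (continuous_gradient_height hc.contDiff).continuousOn
  refine ⟨J.toNNReal * NNReal.sqrt C, fun w hw ↦ ?_⟩
  set Γ : (ℝ ∙ ν)ᗮ → Space d := fun y ↦ graphPoint ν γ y 0 with hΓ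
  have hΓc : Continuous Γ := (continuous_graphPoint hc.contDiff.continuous).comp
    (by fun_prop : Continuous fun y : (ℝ ∙ ν)ᗮ ↦ (y, (0 : ℝ)))
  have hΓ0 (y) : height ν γ (Γ y) = 0 := height_graphPoint hc.norm_eq_one y 0
  set D : Set (ℝ ∙ ν)ᗮ := {y | Γ y ∈ U}
  have hD : IsOpen D := hc.isOpen.preimage hΓc
  have hpt (y) : ‖flux Ω γ χ w (Γ y)‖ₑ ≤ D.indicator (fun y ↦ (J.toNNReal : ℝ≥0∞) *
      (‖χ (Γ y) * w (Γ y)‖ₑ * ‖normalDeriv Ω w (Γ y)‖ₑ)) y := by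
    by_cases hy : Γ y ∈ tsupport χ
    · rw [indicator_of_mem (by exact hχU hy), flux,
        hc.fderivWithin_gradient_height w (hχU hy) (hΓ0 y), enorm_mul (χ _ * w _), enorm_neg,
        enorm_mul ‖gradient (height ν γ) (Γ y)‖, mul_left_comm]
      gcongr
      rw [← ofReal_norm, norm_norm]
      exact ENNReal.ofReal_le_ofReal (hJ _ hy)
    · rw [flux, image_eq_zero_of_notMem_tsupport hy]
      simp
  have hm1 : AEMeasurable (fun y ↦ ‖χ (Γ y) * w (Γ y)‖ₑ) (volume.restrict D) := by
    have : Continuous fun y ↦ χ (Γ y) * w (Γ y) :=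
      (hc.continuousOn_cutoff_mul hχ.continuous hχU hw.continuousOn).comp_continuous hΓc
        fun y ↦ (hΓ0 y).ge
    exact this.measurable.enorm.aemeasurable
  have hm2 : AEMeasurable (fun y ↦ ‖normalDeriv Ω w (Γ y)‖ₑ) (volume.restrict D) := by
    have hcont : ContinuousOn (fun y ↦ -(‖gradient (height ν γ) (Γ y)‖⁻¹ *
        fderivWithin ℝ w (closure Ω) (Γ y) (gradient (height ν γ) (Γ y)))) D := by
      have hgc : Continuous fun y ↦ gradient (height ν γ) (Γ y) :=
        (continuous_gradient_height hc.contDiff).comp hΓc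
      refine ((hgc.norm.inv₀ fun y ↦ norm_ne_zero_iff.2
        (gradient_height_ne_zero hc.norm_eq_one hc.contDiff _)).continuousOn.mul ?_).neg
      refine ContinuousOn.clm_apply ?_ hgc.continuousOn
      exact (hw.continuousOn_fderivWithin huniq le_rfl).comp hΓc.continuousOn
        fun y hy ↦ (hc.mem_closure_iff hy).2 (hΓ0 y).ge
    refine ((hcont.congr fun y hy ↦ ?_).aemeasurable hD.measurableSet).enorm
    have hne := norm_ne_zero_iff.2 (gradient_height_ne_zero hc.norm_eq_one hc.contDiff (Γ y))
    rw [hc.fderivWithin_gradient_height w hy (hΓ0 y)]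
    field_simp
  have hme := measurableEmbedding_graphPoint_zero (ν := ν) hc.contDiff.continuous
  -- no measurability of the normal derivative is needed: the lift is a measurable embedding
  have hbd : ∫⁻ y in D, ‖normalDeriv Ω w (Γ y)‖ₑ ^ 2 ≤
      ∫⁻ x, ‖normalDeriv Ω w x‖ₑ ^ 2 ∂surfaceMeasure Ω := by
    refine le_trans (le_of_eq ?_) (lintegral_mono' (hc.map_graphPoint_le hΩ) le_rfl)
    rw [hme.lintegral_map]
  calc ‖∫ y, flux Ω γ χ w (Γ y)‖ₑ ≤ ∫⁻ y, ‖flux Ω γ χ w (Γ y)‖ₑ :=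
        enorm_integral_le_lintegral_enorm _
    _ ≤ (J.toNNReal : ℝ≥0∞) *
        ∫⁻ y in D, ‖χ (Γ y) * w (Γ y)‖ₑ * ‖normalDeriv Ω w (Γ y)‖ₑ := by
        refine (lintegral_mono hpt).trans (le_of_eq ?_)
        rw [lintegral_indicator hD.measurableSet, lintegral_const_mul' _ _ ENNReal.coe_ne_top]
    _ ≤ (J.toNNReal : ℝ≥0∞) * ((∫⁻ y in D, ‖χ (Γ y) * w (Γ y)‖ₑ ^ 2) ^ (1 / 2 : ℝ) *
        (∫⁻ y in D, ‖normalDeriv Ω w (Γ y)‖ₑ ^ 2) ^ (1 / 2 : ℝ)) := by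
        gcongr
        exact lintegral_mul_le_sqrt hm1 hm2
    _ ≤ (J.toNNReal : ℝ≥0∞) * ((C * h1Norm Ω w ^ 2) ^ (1 / 2 : ℝ) *
        (∫⁻ x, ‖normalDeriv Ω w x‖ₑ ^ 2 ∂surfaceMeasure Ω) ^ (1 / 2 : ℝ)) := by
        gcongr
        exact (setLIntegral_le_lintegral _ _).trans (hC w hw)
    _ = _ := by
        rw [ENNReal.mul_rpow_of_nonneg _ _ (by norm_num), sq_rpow_half, NNReal.sqrt_eq_rpow,
          ENNReal.coe_mul, ← ENNReal.coe_rpow_of_nonneg _ (by norm_num)]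
        ring

end IsGraphChart

end NeumannLS

/-! ### Global Green bound and energy estimate -/

namespace NeumannLS

variable {d : ℕ} {Ω : Set (Space d)}

/-- The estimate of the boundary term in Green's formula, localized to an open set `U`: it is
required for all cutoffs supported in `U`. -/
def HasLocalGreenBound (Ω U : Set (Space d)) : Prop :=
  ∀ χ : Space d → ℝ, ContDiff ℝ 1 χ → HasCompactSupport χ → tsupport χ ⊆ U →
    ∃ C : NNReal, ∀ w h : Space d → ℝ, ContDiffOn ℝ 1 w (closure Ω) → IntegrableOn h Ω →
      (∀ φ : Space d → ℝ, ContDiff ℝ 1 φ → HasCompactSupport φ → tsupport φ ⊆ Ω →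
        ∫ x in Ω, (fderiv ℝ φ x (gradient w x) - h x * φ x) = 0) →
      ‖∫ x in Ω, (fderiv ℝ (fun x ↦ χ x * w x) x (gradient w x) - h x * (χ x * w x))‖ₑ ≤
        C * (h1Norm Ω w * (∫⁻ x, ‖normalDeriv Ω w x‖ₑ ^ 2 ∂surfaceMeasure Ω) ^ (1 / 2 : ℝ))

lemma hasLocalGreenBound_self (hΩ : IsOpen Ω) : HasLocalGreenBound Ω Ω := by
  intro χ hχ hχc hχU
  refine ⟨0, fun w h hw _ H ↦ ?_⟩
  rw [H]
  · simp
  · exact contDiff_of_eq_zero_off hΩ (isClosed_tsupport χ) hχU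
      (hχ.contDiffOn.mul (hw.mono subset_closure))
      fun x hx ↦ by rw [image_eq_zero_of_notMem_tsupport hx, zero_mul]
  · exact hχc.mul_right
  · exact (tsupport_mul_subset_left).trans hχU

lemma IsGraphChart.hasLocalGreenBound {U : Set (Space d)} {ν : Space d} {γ : (ℝ ∙ ν)ᗮ → ℝ}
    (hc : IsGraphChart Ω U ν γ) (hΩ : IsOpen Ω) (hb : Bornology.IsBounded Ω)
    (huniq : UniqueDiffOn ℝ (closure Ω)) : HasLocalGreenBound Ω U := by
  intro χ hχ hχc hχU
  obtain ⟨C, hC⟩ := hc.exists_flux_bound hΩ huniq hχ hχc hχU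
  refine ⟨C, fun w h hw hh H ↦ ?_⟩
  rw [hc.integral_cutoff_eq_neg_flux hΩ hb huniq hχ hχc hχU hw hh H, enorm_neg]
  exact hC w hw

/-- The boundary term in Green's formula on a bounded `C¹` domain is bounded by the `H¹` norm and
the normal derivative in `L²` of the boundary. -/
lemma HasC1Boundary.exists_green_bound (hC1 : HasC1Boundary Ω) (hΩ : IsOpen Ω)
    (hb : Bornology.IsBounded Ω) :
    ∃ C : NNReal, ∀ w h : Space d → ℝ, ContDiffOn ℝ 1 w (closure Ω) → IntegrableOn h Ω →
      (∀ φ : Space d → ℝ, ContDiff ℝ 1 φ → HasCompactSupport φ → tsupport φ ⊆ Ω →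
        ∫ x in Ω, (fderiv ℝ φ x (gradient w x) - h x * φ x) = 0) →
      ‖∫ x in Ω, (fderiv ℝ w x (gradient w x) - h x * w x)‖ₑ ≤
        C * (h1Norm Ω w *
          (∫⁻ x, ‖normalDeriv Ω w x‖ₑ ^ 2 ∂surfaceMeasure Ω) ^ (1 / 2 : ℝ)) := by
  have huniq := hC1.uniqueDiffOn_closure hΩ
  have hloc (x : Space d) : ∃ U : Set (Space d), IsOpen U ∧ (x ∈ closure Ω → x ∈ U) ∧
      HasLocalGreenBound Ω U := by
    by_cases hx : x ∈ frontier Ω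
    · obtain ⟨ν, γ, U, hxU, hc⟩ := hC1.exists_isGraphChart hx
      exact ⟨U, hc.isOpen, fun _ ↦ hxU, hc.hasLocalGreenBound hΩ hb huniq⟩
    · refine ⟨Ω, hΩ, fun h ↦ by_contra fun h' ↦ hx ?_, hasLocalGreenBound_self hΩ⟩
      rw [hΩ.frontier_eq]
      exact ⟨h, h'⟩
  choose U hUo hxU hUb using hloc
  obtain ⟨R, hR⟩ := hb.isCompact_closure.isBounded.subset_ball (0 : Space d)
  obtain ⟨t, ht⟩ := hb.isCompact_closure.elim_nhds_subcover'
    (fun x hx ↦ U x) fun x hx ↦ (hUo x).mem_nhds (hxU x hx)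
  obtain ⟨χ, hχ⟩ := SmoothPartitionOfUnity.exists_isSubordinate
    (modelWithCornersSelf ℝ (Space d)) (s := closure Ω) isClosed_closure
    (fun i : t ↦ U i.1 ∩ Metric.ball 0 R) (fun i ↦ (hUo i.1).inter Metric.isOpen_ball) (by
      intro x hx
      obtain ⟨i, hi, hxi⟩ := mem_iUnion₂.1 (ht hx)
      exact mem_iUnion.2 ⟨⟨i, hi⟩, hxi, hR hx⟩)
  have hχC (i : t) : ContDiff ℝ 1 (χ i) := ((χ i).contMDiff.contDiff).of_le (by norm_cast)
  have hχU (i : t) : tsupport (χ i) ⊆ U i.1 := (hχ i).trans inter_subset_left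
  have hχc (i : t) : HasCompactSupport (χ i) :=
    Metric.isCompact_of_isClosed_isBounded (isClosed_tsupport _)
      (Metric.isBounded_ball.subset ((hχ i).trans inter_subset_right))
  choose C hC using fun i : t ↦ hUb i.1 (χ i) (hχC i) (hχc i) (hχU i)
  refine ⟨∑ i, C i, fun w h hw hh H ↦ ?_⟩
  have hsum (x) (hx : x ∈ Ω) : ∑ i, χ i x = 1 := by
    have := χ.sum_eq_one (subset_closure hx)
    rwa [finsum_eq_sum_of_fintype] at this
  have hpt : ∀ x ∈ Ω, fderiv ℝ w x (gradient w x) - h x * w x =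
      ∑ i, (fderiv ℝ (fun x ↦ χ i x * w x) x (gradient w x) - h x * (χ i x * w x)) := by
    intro x hx
    have hwd : DifferentiableAt ℝ w x :=
      (hw.contDiffAt (Filter.mem_of_superset (hΩ.mem_nhds hx) subset_closure)).differentiableAt
        one_ne_zero
    have e1 : w =ᶠ[𝓝 x] fun z ↦ ∑ i, χ i z * w z := by
      filter_upwards [hΩ.mem_nhds hx] with z hz
      rw [← Finset.sum_mul, hsum z hz, one_mul]
    have e2 : fderiv ℝ w x = ∑ i, fderiv ℝ (fun x ↦ χ i x * w x) x := by
      rw [e1.fderiv_eq]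
      exact fderiv_fun_sum fun i _ ↦ ((hχC i).differentiable one_ne_zero x).mul hwd
    rw [Finset.sum_sub_distrib, ← Finset.mul_sum, ← Finset.sum_mul, hsum x hx, one_mul]
    conv_lhs => rw [e2]
    rw [sum_apply]
  rw [setIntegral_congr_fun hΩ.measurableSet hpt, integral_finsetSum _ fun i _ ↦
    integrableOn_cutoff_weak_integrand hΩ hb huniq (hχC i) (hχc i) hw hh]
  refine (enorm_sum_le _ _).trans ((Finset.sum_le_sum fun i _ ↦ hC i w h hw hh H).trans ?_)
  rw [← Finset.sum_mul]
  push_cast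
  exact le_rfl

section Residuals

variable {c f g u ustar : Space d → ℝ}

lemma normalDeriv_sub (huniq : UniqueDiffOn ℝ (closure Ω)) (hu : ContDiffOn ℝ 1 u (closure Ω))
    (hs : ContDiffOn ℝ 1 ustar (closure Ω)) {x : Space d} (hx : x ∈ closure Ω) :
    normalDeriv Ω (u - ustar) x = normalDeriv Ω u x - normalDeriv Ω ustar x := by
  rw [normalDeriv, fderivWithin_sub (huniq x hx) (hu.differentiableOn one_ne_zero x hx)
    (hs.differentiableOn one_ne_zero x hx)]
  rfl

lemma ae_normalDeriv_sub (huniq : UniqueDiffOn ℝ (closure Ω))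
    (hu : ContDiffOn ℝ 1 u (closure Ω)) (hs : IsNeumannSolution Ω c f g ustar) :
    ∀ᵐ x ∂surfaceMeasure Ω, normalDeriv Ω (u - ustar) x = boundaryResidual Ω g u x := by
  have h1 : ∀ᵐ x ∂surfaceMeasure Ω, x ∈ frontier Ω :=
    ae_restrict_mem isClosed_frontier.measurableSet
  filter_upwards [h1, hs.boundary] with x hx hg
  rw [normalDeriv_sub huniq hu hs.contDiffOn (frontier_subset_closure hx), hg, boundaryResidual]

lemma integrableOn_mul_of_contDiffOn_closure (hΩ : IsOpen Ω) (hb : Bornology.IsBounded Ω)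
    (huniq : UniqueDiffOn ℝ (closure Ω)) {w : Space d → ℝ} (hw : ContDiffOn ℝ 1 w (closure Ω))
    (hc : IntegrableOn c Ω) : IntegrableOn (fun x ↦ c x * w x) Ω := by
  obtain ⟨M, hM⟩ := exists_bound_of_contDiffOn_closure hΩ hb huniq hw
  refine Integrable.mul_bdd (c := M) hc
    ((hw.continuousOn.mono subset_closure).aestronglyMeasurable hΩ.measurableSet) ?_
  exact (ae_restrict_iff' hΩ.measurableSet).2 (Filter.Eventually.of_forall fun x hx ↦ (hM x hx).1)

/-- The difference of an approximation `u` and the solution satisfies weakly the equation whose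
right-hand side is the residual of `u`. -/
lemma IsNeumannSolution.weak_eq_sub (hs : IsNeumannSolution Ω c f g ustar) (hΩ : IsOpen Ω)
    (hb : Bornology.IsBounded Ω) (huniq : UniqueDiffOn ℝ (closure Ω))
    (hu : ContDiffOn ℝ 2 u (closure Ω)) (hc : IntegrableOn c Ω) (hf : IntegrableOn f Ω)
    (hR : IntegrableOn (interiorResidual c f u) Ω) {φ : Space d → ℝ} (hφ : ContDiff ℝ 1 φ)
    (hφc : HasCompactSupport φ) (hφs : tsupport φ ⊆ Ω) :
    ∫ x in Ω, (fderiv ℝ φ x (gradient (u - ustar) x) -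
      (interiorResidual c f u x - c x * (u - ustar) x) * φ x) = 0 := by
  have hu1 : ContDiffOn ℝ 1 u (closure Ω) := hu.of_le (by norm_num)
  have hw : ContDiffOn ℝ 1 (u - ustar) (closure Ω) := hu1.sub hs.contDiffOn
  refine weak_eq_of_contDiff_one hΩ (μ := volume.restrict Ω)
    (G := gradient (u - ustar)) (h := fun x ↦ interiorResidual c f u x - c x * (u - ustar) x)
    (integrableOn_gradient hΩ hb huniq hw)
    (hR.sub (integrableOn_mul_of_contDiffOn_closure hΩ hb huniq hw hc)) ?_ hφ hφc hφs
  intro φ hφ hφc hφs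
  have hφ1 : ContDiff ℝ 1 φ := hφ.of_le (by norm_cast)
  have hcu := integrableOn_mul_of_contDiffOn_closure hΩ hb huniq hu1 hc
  have hcs := integrableOn_mul_of_contDiffOn_closure hΩ hb huniq hs.contDiffOn hc
  have hlap : IntegrableOn (fun x ↦ -Laplacian.laplacian u x) Ω := by
    refine ((hR.sub hcu).add hf).congr (Filter.Eventually.of_forall fun x ↦ ?_)
    simp only [interiorResidual, Pi.add_apply, Pi.sub_apply]
    ring
  have i1 : IntegrableOn (fun x ↦ fderiv ℝ φ x (gradient u x)) Ω :=
    integrable_fderiv_apply hφ1 hφc (integrableOn_gradient hΩ hb huniq hu1)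
  have i2 : IntegrableOn (fun x ↦ inner ℝ (gradient ustar x) (gradient φ x)) Ω := by
    refine (integrable_fderiv_apply hφ1 hφc
      (integrableOn_gradient hΩ hb huniq hs.contDiffOn)).congr
      (Filter.Eventually.of_forall fun x ↦ ?_)
    simp only
    rw [real_inner_comm, inner_gradient_left]
  have i3 := integrable_mul_of_hasCompactSupport hφ.continuous hφc hlap
  have i4 := integrable_mul_of_hasCompactSupport hφ.continuous hφc hcs
  have i5 := integrable_mul_of_hasCompactSupport hφ.continuous hφc hf
  have hpt : ∀ x ∈ Ω, fderiv ℝ φ x (gradient (u - ustar) x) -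
      (interiorResidual c f u x - c x * (u - ustar) x) * φ x =
      (fderiv ℝ φ x (gradient u x) - -Laplacian.laplacian u x * φ x) -
        ((inner ℝ (gradient ustar x) (gradient φ x) + c x * ustar x * φ x) - f x * φ x) := by
    intro x hx
    have hn : closure Ω ∈ 𝓝 x := Filter.mem_of_superset (hΩ.mem_nhds hx) subset_closure
    have d1 := (hu1.contDiffAt hn).differentiableAt one_ne_zero
    have d2 := (hs.contDiffOn.contDiffAt hn).differentiableAt one_ne_zero
    have e1 : gradient (u - ustar) x = gradient u x - gradient ustar x := by
      rw [gradient, fderiv_sub d1 d2, map_sub]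
      rfl
    rw [e1, map_sub, real_inner_comm, inner_gradient_left, interiorResidual, Pi.sub_apply]
    ring
  have i13 : IntegrableOn (fun x ↦ fderiv ℝ φ x (gradient u x) -
      -Laplacian.laplacian u x * φ x) Ω := i1.sub i3
  have i24 : IntegrableOn (fun x ↦ inner ℝ (gradient ustar x) (gradient φ x) +
      c x * ustar x * φ x) Ω := i2.add i4
  have i245 : IntegrableOn (fun x ↦ (inner ℝ (gradient ustar x) (gradient φ x) +
      c x * ustar x * φ x) - f x * φ x) Ω := i24.sub i5
  rw [setIntegral_congr_fun hΩ.measurableSet hpt, integral_sub i13 i245,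
    integral_sub i1 i3, integral_sub i24 i5, integral_add i2 i4,
    integral_fderiv_gradient hΩ (hu.mono subset_closure) hφ hφc hφs, hs.equation φ hφ hφc hφs]
  ring

/-- The energy estimate: testing the equation for `w = u - ustar` with `w` itself. -/
lemma HasC1Boundary.exists_energy_bound (hC1 : HasC1Boundary Ω) (hΩ : IsOpen Ω)
    (hb : Bornology.IsBounded Ω) :
    ∃ C : NNReal, ∀ (σ : ℝ) (c f g u ustar : Space d → ℝ), 0 < σ →
      MemLp c 2 (volume.restrict Ω) → (∀ᵐ x ∂(volume.restrict Ω), σ ≤ c x) →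
      MemLp f 2 (volume.restrict Ω) → IsNeumannSolution Ω c f g ustar →
      ContDiffOn ℝ 2 u (closure Ω) → ∫⁻ x in Ω, ‖interiorResidual c f u x‖ₑ ^ 2 ≠ ⊤ →
      ENNReal.ofReal (min 1 σ) * h1Norm Ω (u - ustar) ≤
        (∫⁻ x in Ω, ‖interiorResidual c f u x‖ₑ ^ 2) ^ (1 / 2 : ℝ) +
        C * (∫⁻ x, ‖boundaryResidual Ω g u x‖ₑ ^ 2 ∂surfaceMeasure Ω) ^ (1 / 2 : ℝ) := by
  obtain ⟨C, hC⟩ := hC1.exists_green_bound hΩ hb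
  have huniq := hC1.uniqueDiffOn_closure hΩ
  refine ⟨C, fun σ c f g u ustar hσ hc hcσ hf hs hu hfin ↦ ?_⟩
  have hu1 : ContDiffOn ℝ 1 u (closure Ω) := hu.of_le (by norm_num)
  have hw : ContDiffOn ℝ 1 (u - ustar) (closure Ω) := hu1.sub hs.contDiffOn
  have hwΩ : ContDiffOn ℝ 1 (u - ustar) Ω := hw.mono subset_closure
  have : IsFiniteMeasure (volume.restrict Ω) := ⟨by simpa using hb.measure_lt_top⟩
  have hci : IntegrableOn c Ω := hc.integrable one_le_two
  have hfi : IntegrableOn f Ω := hf.integrable one_le_two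
  set R := interiorResidual c f u
  have hRm : AEStronglyMeasurable R (volume.restrict Ω) := by
    have h1 := (continuousOn_laplacian hΩ (hu.mono subset_closure)).aestronglyMeasurable
      (μ := volume) hΩ.measurableSet
    have h2 := (hu.continuousOn.mono subset_closure).aestronglyMeasurable
      (μ := volume) hΩ.measurableSet
    exact (h1.neg.add (hc.aestronglyMeasurable.mul h2)).sub hf.aestronglyMeasurable
  have hRL : MemLp R 2 (volume.restrict Ω) := by
    refine ⟨hRm, ?_⟩
    rw [eLpNorm_lt_top_iff_lintegral_rpow_enorm_lt_top (by norm_num) (by norm_num)]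
    simpa using lt_top_iff_ne_top.2 hfin
  have hRi : IntegrableOn R Ω := hRL.integrable one_le_two
  set w := u - ustar with hwdef
  have hcw := integrableOn_mul_of_contDiffOn_closure hΩ hb huniq hw hci
  have hcww := integrableOn_mul_of_contDiffOn_closure hΩ hb huniq hw hcw
  have hRw := integrableOn_mul_of_contDiffOn_closure hΩ hb huniq hw hRi
  have hgreen := hC w (fun x ↦ R x - c x * w x) hw (hRi.sub hcw)
    fun φ h1 h2 h3 ↦ hs.weak_eq_sub hΩ hb huniq hu hci hfi hRi h1 h2 h3
  have hboundary : ∫⁻ x, ‖normalDeriv Ω w x‖ₑ ^ 2 ∂surfaceMeasure Ω =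
      ∫⁻ x, ‖boundaryResidual Ω g u x‖ₑ ^ 2 ∂surfaceMeasure Ω := by
    refine lintegral_congr_ae ((ae_normalDeriv_sub huniq hu1 hs).mono fun x hx ↦ ?_)
    simp only [hwdef, hx]
  rw [hboundary] at hgreen
  obtain ⟨M, hM⟩ := exists_bound_of_contDiffOn_closure hΩ hb huniq hw
  have hgrad (x) : fderiv ℝ w x (gradient w x) = ‖gradient w x‖ ^ 2 := by
    rw [← inner_gradient_left, real_inner_self_eq_norm_sq]
  have hgi : IntegrableOn (fun x ↦ ‖gradient w x‖ ^ 2) Ω := by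
    refine integrableOn_of_continuousOn_of_bound hΩ hb (M := M ^ 2)
      ((continuousOn_gradient hΩ hwΩ).norm.pow 2) fun x hx ↦ ?_
    rw [norm_pow, norm_norm, norm_gradient]
    exact pow_le_pow_left₀ (norm_nonneg _) (hM x hx).2 2
  have hwi : IntegrableOn (fun x ↦ ‖w x‖ ^ 2) Ω := by
    refine integrableOn_of_continuousOn_of_bound hΩ hb (M := M ^ 2)
      (hwΩ.continuousOn.norm.pow 2) fun x hx ↦ ?_
    rw [norm_pow, norm_norm]
    exact pow_le_pow_left₀ (norm_nonneg _) (hM x hx).1 2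
  have hwgi : IntegrableOn (fun x ↦ ‖w x‖ ^ 2 + ‖gradient w x‖ ^ 2) Ω := hwi.add hgi
  have hgci : IntegrableOn (fun x ↦ ‖gradient w x‖ ^ 2 + c x * w x * w x) Ω := hgi.add hcww
  set N := h1Norm Ω w with hN
  have hNfin : N ≠ ⊤ := by
    have h1 : N ^ 2 ≠ ⊤ := by
      have h2 : ∫⁻ x in Ω, ENNReal.ofReal (‖w x‖ ^ 2 + ‖gradient w x‖ ^ 2) ≠ ⊤ := by
        rw [← ofReal_integral_eq_lintegral_ofReal hwgi
          (Filter.Eventually.of_forall fun x ↦ by positivity)]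
        exact ENNReal.ofReal_ne_top
      rw [hN, h1Norm_sq]
      convert h2 using 3 with x
      rw [ENNReal.ofReal_add (by positivity) (by positivity), ENNReal.ofReal_pow (norm_nonneg _),
        ENNReal.ofReal_pow (norm_nonneg _), ofReal_norm, ofReal_norm]
    exact fun h ↦ h1 (by rw [h]; rfl)
  -- coercivity of the quadratic form
  have henergy : ENNReal.ofReal (min 1 σ) * N ^ 2 ≤
      ENNReal.ofReal (∫ x in Ω, (‖gradient w x‖ ^ 2 + c x * w x * w x)) := by
    rw [ofReal_integral_eq_lintegral_ofReal hgci (by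
        filter_upwards [hcσ] with x hx
        have : 0 ≤ c x * (w x * w x) := mul_nonneg (hσ.le.trans hx) (mul_self_nonneg _)
        simp only [Pi.zero_apply]
        nlinarith [sq_nonneg ‖gradient w x‖]),
      hN, h1Norm_sq, ← lintegral_const_mul' _ _ ENNReal.ofReal_ne_top]
    refine lintegral_mono_ae ?_
    filter_upwards [hcσ] with x hx
    rw [← ofReal_norm, ← ofReal_norm, ← ENNReal.ofReal_pow (norm_nonneg _),
      ← ENNReal.ofReal_pow (norm_nonneg _), ← ENNReal.ofReal_add (by positivity) (by positivity),
      ← ENNReal.ofReal_mul (le_min zero_le_one hσ.le)]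
    refine ENNReal.ofReal_le_ofReal ?_
    have h1 : min 1 σ ≤ 1 := min_le_left _ _
    have h2 : min 1 σ ≤ c x := (min_le_right _ _).trans hx
    have h3 : ‖w x‖ ^ 2 = w x * w x := by rw [Real.norm_eq_abs, sq_abs, sq]
    rw [h3]
    nlinarith [mul_le_mul_of_nonneg_right h1 (sq_nonneg ‖gradient w x‖),
      mul_le_mul_of_nonneg_right h2 (mul_self_nonneg (w x))]
  have hsplit : ∫ x in Ω, (‖gradient w x‖ ^ 2 + c x * w x * w x) =
      (∫ x in Ω, R x * w x) +
        ∫ x in Ω, (fderiv ℝ w x (gradient w x) - (R x - c x * w x) * w x) := by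
    have hi : IntegrableOn (fun x ↦ fderiv ℝ w x (gradient w x) - (R x - c x * w x) * w x) Ω := by
      refine ((hgi.add hcww).sub hRw).congr (Filter.Eventually.of_forall fun x ↦ ?_)
      simp only [Pi.add_apply, Pi.sub_apply, hgrad]
      ring
    rw [← integral_add hRw hi]
    refine integral_congr_ae (Filter.Eventually.of_forall fun x ↦ ?_)
    simp only [hgrad]
    ring
  have hRbound : ‖∫ x in Ω, R x * w x‖ₑ ≤ (∫⁻ x in Ω, ‖R x‖ₑ ^ 2) ^ (1 / 2 : ℝ) * N := by
    refine (enorm_integral_le_lintegral_enorm _).trans ?_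
    simp_rw [enorm_mul]
    refine (lintegral_mul_le_sqrt hRm.enorm
      (hwΩ.continuousOn.aestronglyMeasurable hΩ.measurableSet).enorm).trans ?_
    gcongr
    rw [hN, h1Norm]
    gcongr with x
    exact le_self_add
  have hfinal : ENNReal.ofReal (min 1 σ) * N * N ≤
      ((∫⁻ x in Ω, ‖R x‖ₑ ^ 2) ^ (1 / 2 : ℝ) +
        C * (∫⁻ x, ‖boundaryResidual Ω g u x‖ₑ ^ 2 ∂surfaceMeasure Ω) ^ (1 / 2 : ℝ)) * N := by
    rw [mul_assoc, ← sq]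
    refine henergy.trans ?_
    refine (Real.ofReal_le_enorm _).trans ?_
    rw [hsplit]
    refine (enorm_add_le _ _).trans ((add_le_add hRbound hgreen).trans (le_of_eq ?_))
    ring
  rcases eq_or_ne N 0 with h0 | h0
  · rw [h0, mul_zero]
    exact zero_le
  · exact (ENNReal.mul_le_mul_iff_left h0 hNfin).1 hfinal

end Residuals

end NeumannLS

/-! ### Loss functionals and the error bound -/

namespace NeumannLS

variable {d : ℕ} {Ω : Set (Space d)}

lemma lintegral_interiorMeasure (ho : IsOpen Ω) (F : Space d → ℝ≥0∞) :
    ∫⁻ x, F x ∂(interiorMeasure Ω) = ∫⁻ x in Ω, F x :=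
  lintegral_subtype_comap ho.measurableSet F

lemma lintegral_boundaryMeasure (F : Space d → ℝ≥0∞) :
    ∫⁻ x, F x ∂(boundaryMeasure Ω) = ∫⁻ x, F x ∂(surfaceMeasure Ω) := by
  rw [boundaryMeasure, lintegral_subtype_comap isClosed_frontier.measurableSet, surfaceMeasure,
    Measure.restrict_restrict isClosed_frontier.measurableSet, inter_self]

lemma weightedLoss_one (ho : IsOpen Ω) (c f g : Space d → ℝ) (lam : ℝ) (u : Space d → ℝ) :
    weightedLoss Ω c f g lam u 1 1 = leastSquaresLoss Ω c f g lam u := by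
  simp only [weightedLoss, ContinuousMap.one_apply, ENNReal.ofReal_one, one_mul]
  rw [lintegral_interiorMeasure ho (fun x ↦ ‖interiorResidual c f u x‖ₑ ^ 2),
    lintegral_boundaryMeasure (fun x ↦ ‖boundaryResidual Ω g u x‖ₑ ^ 2), leastSquaresLoss]

lemma interiorMean_one (ho : IsOpen Ω) (hne : Ω.Nonempty) (hb : Bornology.IsBounded Ω) :
    interiorMean Ω 1 = 1 := by
  simp only [interiorMean, ContinuousMap.one_apply, ENNReal.ofReal_one]
  rw [lintegral_interiorMeasure ho (fun _ ↦ 1), setLIntegral_one]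
  exact ENNReal.div_self (ho.measure_pos volume hne).ne' hb.measure_lt_top.ne

lemma HasC1Boundary.boundaryMean_one (hC1 : HasC1Boundary Ω) (hd : 0 < d) (ho : IsOpen Ω)
    (hne : Ω.Nonempty) (hb : Bornology.IsBounded Ω) : boundaryMean Ω 1 = 1 := by
  simp only [boundaryMean, ContinuousMap.one_apply, ENNReal.ofReal_one]
  rw [lintegral_boundaryMeasure (fun _ ↦ 1), lintegral_one]
  exact ENNReal.div_self (hC1.surfaceMeasure_univ_ne_zero hd ho hne hb)
    (hC1.surfaceMeasure_univ_lt_top ho hb).ne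

/-- The SelectNet loss dominates the least squares loss, which is its value at constant weights
equal to one, where the penalty vanishes. -/
lemma HasC1Boundary.leastSquaresLoss_le_selectNetLoss (hC1 : HasC1Boundary Ω) (hd : 0 < d)
    (ho : IsOpen Ω) (hne : Ω.Nonempty) (hb : Bornology.IsBounded Ω) (c f g : Space d → ℝ)
    (lam ε : ℝ) {S₁ : Set C(Ω, ℝ)} {S₂ : Set C(frontier Ω, ℝ)} (h₁ : (1 : C(Ω, ℝ)) ∈ S₁)
    (h₂ : (1 : C(frontier Ω, ℝ)) ∈ S₂) (u : Space d → ℝ) :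
    (leastSquaresLoss Ω c f g lam u : EReal) ≤ selectNetLoss Ω c f g lam ε S₁ S₂ u := by
  have h : penalizedLoss Ω c f g lam ε u 1 1 = (leastSquaresLoss Ω c f g lam u : EReal) := by
    rw [penalizedLoss, weightedLoss_one ho, interiorMean_one ho hne hb,
      hC1.boundaryMean_one hd ho hne hb]
    have : ((1 : ℝ≥0∞) : EReal) - 1 = 0 := by
      rw [EReal.coe_ennreal_one, ← EReal.coe_one, ← EReal.coe_sub, sub_self, EReal.coe_zero]
    rw [this]
    simp
  rw [← h]
  exact le_iSup₂_of_le 1 h₁ (le_iSup₂_of_le 1 h₂ le_rfl)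

lemma rpow_half_le {a : ℝ≥0∞} {b : ℝ} (h : a ≤ ENNReal.ofReal b) :
    a ^ (1 / 2 : ℝ) ≤ ENNReal.ofReal (b ^ (1 / 2 : ℝ)) := by
  rcases le_or_gt b 0 with hb | hb
  · rw [ENNReal.ofReal_of_nonpos hb] at h
    rw [le_zero_iff.1 h, ENNReal.zero_rpow_of_pos (by norm_num)]
    exact zero_le
  · rw [← ENNReal.ofReal_rpow_of_pos hb]
    gcongr

/-- The a posteriori bound for the least squares loss. -/
lemma HasC1Boundary.exists_h1Norm_bound (hC1 : HasC1Boundary Ω) (hΩ : IsOpen Ω)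
    (hb : Bornology.IsBounded Ω) :
    ∃ C : ℝ, 0 < C ∧ ∀ (σ lam δ : ℝ) (c f g u ustar : Space d → ℝ), 0 < σ → 0 < lam →
      MemLp c 2 (volume.restrict Ω) → (∀ᵐ x ∂(volume.restrict Ω), σ ≤ c x) →
      MemLp f 2 (volume.restrict Ω) → IsNeumannSolution Ω c f g ustar →
      ContDiffOn ℝ 2 u (closure Ω) → leastSquaresLoss Ω c f g lam u < ENNReal.ofReal δ →
      h1Norm Ω (u - ustar) ≤
        ENNReal.ofReal (C * max 1 σ⁻¹ * max 1 (lam ^ (-(1 / 2) : ℝ)) * δ ^ (1 / 2 : ℝ)) := by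
  obtain ⟨C, hC⟩ := hC1.exists_energy_bound hΩ hb
  refine ⟨1 + C, by positivity, fun σ lam δ c f g u ustar hσ hlam hc hcσ hf hs hu hloss ↦ ?_⟩
  have hδ : 0 < δ := ENNReal.ofReal_pos.1 (pos_of_gt hloss)
  set a := ∫⁻ x in Ω, ‖interiorResidual c f u x‖ₑ ^ 2
  set b := ∫⁻ x, ‖boundaryResidual Ω g u x‖ₑ ^ 2 ∂surfaceMeasure Ω
  have hloss' : a + ENNReal.ofReal lam * b < ENNReal.ofReal δ := hloss
  have ha : a ≤ ENNReal.ofReal δ := le_self_add.trans hloss'.le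
  have hb' : b ≤ ENNReal.ofReal (lam⁻¹ * δ) := by
    rw [ENNReal.ofReal_mul (inv_nonneg.2 hlam.le), ENNReal.ofReal_inv_of_pos hlam, mul_comm,
      ← div_eq_mul_inv, ENNReal.le_div_iff_mul_le (Or.inl (ENNReal.ofReal_pos.2 hlam).ne')
        (Or.inl ENNReal.ofReal_ne_top), mul_comm]
    exact le_add_self.trans hloss'.le
  have key := hC σ c f g u ustar hσ hc hcσ hf hs hu (ha.trans_lt ENNReal.ofReal_lt_top).ne
  have hm : 0 < min 1 σ := lt_min one_pos hσ
  have hmax : (min 1 σ)⁻¹ = max 1 σ⁻¹ := by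
    rcases le_total 1 σ with h | h
    · rw [min_eq_left h, max_eq_left (inv_le_one_of_one_le₀ h), inv_one]
    · rw [min_eq_right h, max_eq_right ((one_le_inv₀ hσ).2 h)]
  have hle : ENNReal.ofReal (min 1 σ) * h1Norm Ω (u - ustar) ≤
      ENNReal.ofReal (δ ^ (1 / 2 : ℝ) + C * (lam⁻¹ * δ) ^ (1 / 2 : ℝ)) := by
    refine key.trans ?_
    rw [ENNReal.ofReal_add (by positivity) (by positivity), ENNReal.ofReal_mul C.coe_nonneg,
      ENNReal.ofReal_coe_nnreal]
    exact add_le_add (rpow_half_le ha) (mul_le_mul_right (rpow_half_le hb') _)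
  have hdiv : h1Norm Ω (u - ustar) ≤ ENNReal.ofReal (max 1 σ⁻¹ *
      (δ ^ (1 / 2 : ℝ) + C * (lam⁻¹ * δ) ^ (1 / 2 : ℝ))) := by
    rw [← hmax, mul_comm, ← div_eq_mul_inv, ENNReal.ofReal_div_of_pos hm,
      ENNReal.le_div_iff_mul_le (Or.inl (ENNReal.ofReal_pos.2 hm).ne')
        (Or.inl ENNReal.ofReal_ne_top), mul_comm]
    exact hle
  refine hdiv.trans (ENNReal.ofReal_le_ofReal ?_)
  have h1 : (lam⁻¹ * δ) ^ (1 / 2 : ℝ) = lam ^ (-(1 / 2) : ℝ) * δ ^ (1 / 2 : ℝ) := by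
    rw [Real.mul_rpow (inv_nonneg.2 hlam.le) hδ.le, Real.inv_rpow hlam.le, Real.rpow_neg hlam.le]
  rw [h1]
  set L := lam ^ (-(1 / 2) : ℝ)
  set D := δ ^ (1 / 2 : ℝ)
  have hD : 0 ≤ D := by positivity
  have hC0 : (0 : ℝ) ≤ C := C.2
  have h2 : D ≤ max 1 L * D := le_mul_of_one_le_left hD (le_max_left _ _)
  have h3 : C * (L * D) ≤ C * (max 1 L * D) := by
    gcongr
    exact le_max_right _ _
  calc max 1 σ⁻¹ * (D + C * (L * D)) ≤ max 1 σ⁻¹ * (max 1 L * D + C * (max 1 L * D)) := by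
        gcongr
    _ = _ := by ring

end NeumannLS

theorem theorem4p1 (d : ℕ) (hd : 0 < d) (Ω : Set (NeumannLS.Space d))
    (hΩ_open : IsOpen Ω) (hΩ_nonempty : Ω.Nonempty) (hΩ_bounded : Bornology.IsBounded Ω)
    (hΩ_C1 : NeumannLS.HasC1Boundary Ω) :
    ∃ C : ℝ, 0 < C ∧
      ∀ (σ lam δ : ℝ) (c f g ustar : NeumannLS.Space d → ℝ) (N : Set (NeumannLS.Space d → ℝ)),
        0 < σ → 0 < lam →
        MemLp c 2 (volume.restrict Ω) → (∀ᵐ x ∂(volume.restrict Ω), σ ≤ c x) →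
        MemLp f 2 (volume.restrict Ω) → MemLp g 2 (NeumannLS.surfaceMeasure Ω) →
        NeumannLS.IsNeumannSolution Ω c f g ustar →
        (∀ u ∈ N, ContDiffOn ℝ 2 u (closure Ω)) →
        (∀ ub ∈ N, NeumannLS.leastSquaresLoss Ω c f g lam ub < ENNReal.ofReal δ →
          NeumannLS.h1Norm Ω (ub - ustar) ≤
            ENNReal.ofReal (C * max 1 σ⁻¹ * max 1 (lam ^ (-(1 / 2) : ℝ)) * δ ^ (1 / 2 : ℝ))) ∧
        (∀ (ε : ℝ) (S₁ : Set C(Ω, ℝ)) (S₂ : Set C(frontier Ω, ℝ)), 0 < ε →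
          (∀ φ ∈ S₁, ∀ x, 0 < φ x) → (1 : C(Ω, ℝ)) ∈ S₁ →
          (∀ φ ∈ S₂, ∀ x, 0 < φ x) → (1 : C(frontier Ω, ℝ)) ∈ S₂ →
          ∀ us ∈ N, NeumannLS.selectNetLoss Ω c f g lam ε S₁ S₂ us < ((δ : ℝ) : EReal) →
            NeumannLS.h1Norm Ω (us - ustar) ≤
              ENNReal.ofReal
                (C * max 1 σ⁻¹ * max 1 (lam ^ (-(1 / 2) : ℝ)) * δ ^ (1 / 2 : ℝ))) := by
  obtain ⟨C, hC0, hC⟩ := hΩ_C1.exists_h1Norm_bound hΩ_open hΩ_bounded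
  refine ⟨C, hC0, fun σ lam δ c f g ustar N hσ hlam hc hcσ hf _ hs hN ↦
    ⟨fun ub hub hloss ↦ hC σ lam δ c f g ub ustar hσ hlam hc hcσ hf hs (hN ub hub) hloss,
      fun ε S₁ S₂ _ _ h₁ _ h₂ us hus hloss ↦
        hC σ lam δ c f g us ustar hσ hlam hc hcσ hf hs (hN us hus) ?_⟩⟩
  have h := (hΩ_C1.leastSquaresLoss_le_selectNetLoss hd hΩ_open hΩ_nonempty hΩ_bounded c f g lam ε
    h₁ h₂ us).trans_lt hloss
  rw [← EReal.coe_ennreal_lt_coe_ennreal_iff]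
  refine h.trans_le ?_
  rw [EReal.coe_ennreal_ofReal]
  exact EReal.coe_le_coe_iff.2 (le_max_left _ _)
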